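/- **Setting.** Two sellers offer an item to a unit-demand buyer. Her values $v_1,v_2$ are i.i.d. from a distribution $F$ with a density $f$ supported in $[V,V+1]$, where $V\ge 2$. Assume that $f$ is differentiable on some interval $(V,V+\varepsilon)$ and that the limits $f(V^+)=\lim_{s\downarrow V}f(s)$ and $f'(V^+)=\lim_{s\downarrow V}f'(s)$ exist and are finite. The sellers post visible prices. A prominence mechanism maps the price profile to the probabilities $x_1,x_2\ge 0$, $x_1+x_2\le 1$, with which each seller is made prominent. Inspecting the prominent seller costs $0$, inspecting any other seller costs $c$. The buyer then follows Weitzman's index policy: seller $i$ with price $p_i$ and inspection cost $c_i$ has the index $\theta_i$ solving $\mathbb E\big[([v-p_i]^+-\theta_i)^+\big]=c_i$ (the least solution if $c_i=0$); she inspects sellers with nonnegative index in decreasing order of index (a fair coin breaks ties), stops when the utility $v_i-p_i$ found is at least the next index, and buys from the inspected seller with the highest utility if that is nonnegative. Let $Y_i,Z_i$ be the indicators of buying from, and of inspecting, seller $i$. The consumer surplus is $\mathbb E[\sum_i Y_i(v_i-p_i)-\sum_i c_iZ_i]$, the social welfare is $\mathbb E[\sum_i (Y_iv_i-c_iZ_i)]$,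 and a seller's revenue is their price times the probability that the buyer buys from them. A mechanism is standard if it is anonymous and, at every symmetric pure Nash equilibrium (of the sellers' pricing game), always makes some seller prominent. A price $t$ is implementable at cost $c$ if $(t,t)$ is an equilibrium of some standard mechanism. Let $\theta_0(c)$ solve $\mathbb E[(v-\theta)^+]=c$ (the least solution if $c=0$), let $\bar c$ be the cost with $\theta_0(\bar c)=V$, and for $c\in[0,\bar c]$ and $x>0$ let $$\mathcal D_c(x)=\int_V^{\theta_0(c)-x}(1-F(v+x))\,dF(v)\ \text{ if } x<\theta_0(c)-V,\qquad \mathcal D_c(x)=0\ \text{ otherwise},\qquad t^*(c)=\sup_{x>0}\frac{x\,\mathcal D_c(x)}{\frac12-\mathcal D_c(x)} .$$ Let $SW(c)$ and $CS(c)$ be the social welfare and the consumer surplus when both sellers post the price $t^*(c)$ and each is prominent with probability $\frac12$. **Theorem.** Suppose that $f(V^+)^2<\frac1{13}f'(V^+)$. Then: 1. $CS(c)=SW(c)-t^*(c)$ for all $c\in[0,\bar c]$. For every $c\in(0,\bar c)$, no symmetric equilibrium of a standard mechanism gives a consumer surplus above $CS(c)$. For all $c<\bar c$ close enough to $\bar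 c$, $t^*(c)$ is the lowest implementable price and $CS(c)$ is the highest consumer surplus achieved at a symmetric equilibrium of a standard mechanism. 2. $CS(c)\to\mathbb E[v]$ as $c\to\bar c^-$, and $CS(c)\to CS(0)$ as $c\to0^+$. 3. $CS(c)>\mathbb E[v]$ for all $c<\bar c$ close enough to $\bar c$. 4. $CS$ attains its maximum over $[0,\bar c]$ at some cost $c'<\bar c$, and $CS(c')>\mathbb E[v]$. So the consumer surplus is not maximized as $c\to\bar c$: some costs in $(0,\bar c)$ are strictly better. -/

import Mathlib

open MeasureTheory ProbabilityTheory Set Filter Topology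

namespace ProminenceMarket

noncomputable section

/-! Two sellers, indexed by `Fin 2`; the other seller than `i` is `i.rev`.  Values are i.i.d. with
law `μ`; `p` is the profile of prices and `k` the profile of inspection costs. -/

/-- The joint law of the buyer's values for the two sellers. -/
def valueLaw (μ : Measure ℝ) : Measure (Fin 2 → ℝ) := Measure.pi fun _ => μ

/-- The Weitzman index of a seller with price `p` and inspection cost `k`: the `θ` solving
`E[([v - p]⁺ - θ)⁺] = k`.  The left side is continuous and nonincreasing in `θ`, and strictly
decreasing where it is positive, so for `k > 0` this infimum is the unique solution; for `k = 0`
it is the least solution. -/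
def weitzmanIndex (μ : Measure ℝ) (p k : ℝ) : ℝ :=
  sInf {θ : ℝ | ∫ v, max (max (v - p) 0 - θ) 0 ∂μ ≤ k}

/-- `θ₀(c)`: the solution of `E[(v - θ)⁺] = c` (the least one for `c = 0`). -/
def theta0 (μ : Measure ℝ) (c : ℝ) : ℝ :=
  sInf {θ : ℝ | ∫ v, max (v - θ) 0 ∂μ ≤ c}

/-- `c̄`: the cost for which `V` solves `E[(v - θ)⁺] = c`. -/
def cBar (μ : Measure ℝ) (V : ℝ) : ℝ := ∫ v, max (v - V) 0 ∂μ

section Search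

variable (θ p v : Fin 2 → ℝ) (a i : Fin 2)

/-- In the index policy with indices `θ`, where `a` is a seller with the highest index (and comes
first in the order of search), seller `i` is inspected if their index is nonnegative and either
they come first, or the utility found at the first seller is below the index of `i`. -/
def Inspects : Prop := 0 ≤ θ i ∧ (i = a ∨ v a - p a < θ i)

/-- The buyer purchases from `i`: they are inspected, offer nonnegative utility, and offer the
highest utility among the inspected sellers (an exact tie goes to the first one). -/
def Buys : Prop :=
  Inspects θ p v a i ∧ 0 ≤ v i - p i ∧
    ∀ j, j ≠ i → Inspects θ p v a j →
      v j - p j < v i - p i ∨ (v j - p j = v i - p i ∧ i = a)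

/-- The probability that `a` comes first in the order of search: a fair coin decides if the two
indices are equal. -/
def firstProb : ℝ :=
  if θ a.rev < θ a then 1 else if θ a.rev = θ a then 1 / 2 else 0

end Search

/-- The indices of the sellers. -/
def indices (μ : Measure ℝ) (p k : Fin 2 → ℝ) : Fin 2 → ℝ :=
  fun i => weitzmanIndex μ (p i) (k i)

/-- The probability that the buyer purchases from `i`, at prices `p` and inspection costs `k`. -/
def purchaseProb (μ : Measure ℝ) (p k : Fin 2 → ℝ) (i : Fin 2) : ℝ :=
  ∑ a, firstProb (indices μ p k) a * (valueLaw μ).real {v | Buys (indices μ p k) p v a i}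

/-- The buyer's expected utility `E[∑ Yᵢ (vᵢ - pᵢ)] - E[∑ kᵢ Zᵢ]` at prices `p` and inspection
costs `k`. -/
def buyerUtility (μ : Measure ℝ) (p k : Fin 2 → ℝ) : ℝ :=
  ∑ a, firstProb (indices μ p k) a *
    ∫ v, ∑ i, ({v | Buys (indices μ p k) p v a i}.indicator (fun v => v i - p i) v
      - {v | Inspects (indices μ p k) p v a i}.indicator (fun _ => k i) v) ∂(valueLaw μ)

/-- The expected welfare `E[∑ (vᵢ Yᵢ - kᵢ Zᵢ)]` at prices `p` and inspection costs `k`. -/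
def expectedWelfare (μ : Measure ℝ) (p k : Fin 2 → ℝ) : ℝ :=
  ∑ a, firstProb (indices μ p k) a *
    ∫ v, ∑ i, ({v | Buys (indices μ p k) p v a i}.indicator (fun v => v i) v
      - {v | Inspects (indices μ p k) p v a i}.indicator (fun _ => k i) v) ∂(valueLaw μ)

/-- The inspection costs when seller `w` is prominent: `0` for `w` and `c` for the other. -/
def prominentCosts (c : ℝ) (w : Fin 2) : Fin 2 → ℝ := fun i => if i = w then 0 else c

/-- The expectation of a quantity `g` that depends on the inspection costs, when seller `w` is
prominent with probability `x w` and no seller is with the remaining probability. -/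
def average (c : ℝ) (x : Fin 2 → ℝ) (g : (Fin 2 → ℝ) → ℝ) : ℝ :=
  ∑ w, x w * g (prominentCosts c w) + (1 - ∑ w, x w) * g (fun _ => c)

/-- A prominence mechanism: the probability with which each seller wins prominence, as a
function of the prices. -/
structure ProminenceMechanism where
  alloc : (Fin 2 → ℝ) → Fin 2 → ℝ
  alloc_nonneg : ∀ p i, 0 ≤ alloc p i
  sum_alloc_le_one : ∀ p, ∑ i, alloc p i ≤ 1

/-- The expected revenue of seller `i`. -/
def revenue (μ : Measure ℝ) (c : ℝ) (M : ProminenceMechanism) (p : Fin 2 → ℝ) (i : Fin 2) : ℝ :=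
  p i * average c (M.alloc p) fun k => purchaseProb μ p k i

/-- Pure Nash equilibrium of the pricing game under the mechanism `M`. -/
def IsEquilibrium (μ : Measure ℝ) (c : ℝ) (M : ProminenceMechanism) (p : Fin 2 → ℝ) : Prop :=
  ∀ (i : Fin 2) (q : ℝ), revenue μ c M (Function.update p i q) i ≤ revenue μ c M p i

/-- A mechanism is standard if it is anonymous and always allocates prominence at symmetric
equilibria. -/
def IsStandard (μ : Measure ℝ) (c : ℝ) (M : ProminenceMechanism) : Prop :=
  (∀ (σ : Equiv.Perm (Fin 2)) (p : Fin 2 → ℝ) (i : Fin 2),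
      M.alloc p i = M.alloc (fun j => p (σ j)) (σ i)) ∧
    ∀ t : ℝ, IsEquilibrium μ c M (fun _ => t) → ∑ i, M.alloc (fun _ => t) i = 1

/-- `T(c)`: the prices implementable at a symmetric equilibrium of a standard mechanism. -/
def implementablePrices (μ : Measure ℝ) (c : ℝ) : Set ℝ :=
  {t | ∃ M : ProminenceMechanism, IsStandard μ c M ∧ IsEquilibrium μ c M fun _ => t}

/-- The values of consumer surplus achieved at symmetric equilibria of standard mechanisms. -/
def achievableSurplus (μ : Measure ℝ) (c : ℝ) : Set ℝ :=
  {s | ∃ (M : ProminenceMechanism) (t : ℝ), IsStandard μ c M ∧ IsEquilibrium μ c M (fun _ => t) ∧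
    s = average c (M.alloc fun _ => t) fun k => buyerUtility μ (fun _ => t) k}

/-- `D_c(x)` for `x ≥ 0` and two sellers: the demand of a seller who deviates upwards by `x` from a
symmetric equilibrium price, and thereby is not prominent. -/
def deviationDemand (μ : Measure ℝ) (V c x : ℝ) : ℝ :=
  if x < theta0 μ c - V then ∫ v in Icc V (theta0 μ c - x), (1 - cdf μ (v + x)) ∂μ else 0

/-- `t*(c) = sup_{x > 0} x D_c(x) / (1/2 - D_c(x))`. -/
def tStar (μ : Measure ℝ) (V c : ℝ) : ℝ :=
  sSup ((fun x => x * deviationDemand μ V c x / (1 / 2 - deviationDemand μ V c x)) '' Ioi 0)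

/-- The social welfare when both sellers post `t*(c)` and each is prominent with
probability `1/2`. -/
def welfareAtTStar (μ : Measure ℝ) (V c : ℝ) : ℝ :=
  average c (fun _ => 1 / 2) fun k => expectedWelfare μ (fun _ => tStar μ V c) k

/-- The consumer surplus when both sellers post `t*(c)` and each is prominent with
probability `1/2`. -/
def surplusAtTStar (μ : Measure ℝ) (V c : ℝ) : ℝ :=
  average c (fun _ => 1 / 2) fun k => buyerUtility μ (fun _ => tStar μ V c) k

end

end ProminenceMarket

/-!
Fix `c ∈ (0, c̄]` and put `θ = θ₀(c)`. At equal prices `t ≤ V` the second seller is inspected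
exactly when the first value is below `θ`, so the welfare does not depend on `t`: it equals
`E[v] + E[(g(v) - c)⁺]`, where `g(s) = E[(v - s)⁺]`. A seller who deviates from `t` to `t + x` keeps
at least the demand `D_c(x)`, against `1/2` at equilibrium; hence `x D_c(x) ≤ t (1/2 - D_c(x))`,
so `t*(c)` bounds the equilibrium prices from below. For `θ` close to `V` it is itself implemented,
by denying prominence to a seller who deviates: without prominence, undercutting sells with
probability at most `F(θ + t*(c)) ≤ 1/2`.

Near `c̄` put `δ = θ - V`, so `δ → 0⁺`, and write `F(V + s) = a s + b s² / 2 + o(s²)`. By Fubini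
the gain `E[(g(v) - c)⁺]` is `∫_V^θ F (1 - F) = a δ² / 2 + (b / 6 - a² / 3) δ³ + o(δ³)`, while
scaling `x = u δ` gives `t*(c) ≤ a δ² / 2 + γ δ³` for every `γ > b / 8 + a² / 8` (for every
`γ > 4 b / 27` if `a = 0`). There is room for such a `γ < b / 6 - a² / 3` as soon as `11 a² < b`.
-/

namespace ProminenceMarket

section Gain

lemma lipschitzWith_integral_max_sub {Ω : Type*} [MeasurableSpace Ω] {μ : Measure Ω}
    [IsProbabilityMeasure μ] {h : Ω → ℝ} (hh : Integrable h μ) :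
    LipschitzWith 1 fun c => ∫ ω, max (h ω - c) 0 ∂μ := by
  have hint (c : ℝ) : Integrable (fun ω => max (h ω - c) 0) μ :=
    (hh.sub (integrable_const c)).pos_part
  refine LipschitzWith.of_dist_le_mul fun c d => ?_
  rw [Real.dist_eq, ← integral_sub (hint c) (hint d), NNReal.coe_one, one_mul,
    ← Real.norm_eq_abs]
  refine (norm_integral_le_of_norm_le_const (C := dist c d) (ae_of_all _ fun ω => ?_)).trans
    (by simp)
  calc ‖max (h ω - c) 0 - max (h ω - d) 0‖ ≤ |h ω - c - (h ω - d)| := abs_max_sub_max_le_abs _ _ _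
    _ = dist c d := by rw [sub_sub_sub_cancel_left, abs_sub_comm, Real.dist_eq]

lemma integrable_of_ae_mem_isCompact {X : Type*} [TopologicalSpace X] [T2Space X]
    [MeasurableSpace X] [OpensMeasurableSpace X] {μ : Measure X} [IsFiniteMeasure μ] {K : Set X}
    (hK : IsCompact K) (hs : ∀ᵐ x ∂μ, x ∈ K) {φ : X → ℝ} (hφ : Continuous φ) :
    Integrable φ μ := by
  rw [← Measure.restrict_eq_self_of_ae_mem hs]
  exact hφ.continuousOn.integrableOn_compact hK

variable {μ : Measure ℝ} {V W : ℝ}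

lemma integrable_of_ae_mem_Icc [IsFiniteMeasure μ] (hs : ∀ᵐ v ∂μ, v ∈ Icc V W) {φ : ℝ → ℝ}
    (hφ : Continuous φ) : Integrable φ μ :=
  integrable_of_ae_mem_isCompact isCompact_Icc hs hφ

/-- The expected gain `E[(v - θ)⁺]` of a search when the value `θ` is already at hand. -/
noncomputable def searchGain (μ : Measure ℝ) (θ : ℝ) : ℝ := ∫ v, max (v - θ) 0 ∂μ

lemma searchGain_nonneg (θ : ℝ) : 0 ≤ searchGain μ θ :=
  integral_nonneg fun _ => le_max_right _ _

lemma searchGain_eq_zero (hs : ∀ᵐ v ∂μ, v ∈ Icc V W) {θ : ℝ} (h : W ≤ θ) :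
    searchGain μ θ = 0 :=
  integral_eq_zero_of_ae (hs.mono fun _ hv => max_eq_right (by linarith [hv.2]))

lemma integral_max_max_sub_of_nonneg (p : ℝ) {θ : ℝ} (h : 0 ≤ θ) :
    ∫ v, max (max (v - p) 0 - θ) 0 ∂μ = searchGain μ (p + θ) := by
  refine integral_congr_ae (ae_of_all _ fun v => ?_)
  simp only
  rw [← max_sub_sub_right, max_assoc, max_eq_right (by linarith : 0 - θ ≤ 0), sub_sub]

section Finite

variable [IsFiniteMeasure μ]

lemma integrable_max_sub (hs : ∀ᵐ v ∂μ, v ∈ Icc V W) (θ : ℝ) :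
    Integrable (fun v => max (v - θ) 0) μ :=
  integrable_of_ae_mem_Icc hs (by fun_prop)

lemma searchGain_antitone (hs : ∀ᵐ v ∂μ, v ∈ Icc V W) : Antitone (searchGain μ) :=
  fun _ _ h => integral_mono (integrable_max_sub hs _) (integrable_max_sub hs _) fun v =>
    max_le_max (sub_le_sub_left h v) le_rfl

end Finite

variable [IsProbabilityMeasure μ]

lemma continuous_searchGain (hs : ∀ᵐ v ∂μ, v ∈ Icc V W) : Continuous (searchGain μ) :=
  (lipschitzWith_integral_max_sub (integrable_of_ae_mem_Icc hs continuous_id)).continuous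

lemma searchGain_le_add (hs : ∀ᵐ v ∂μ, v ∈ Icc V W) {θ θ' : ℝ} (h : θ ≤ θ') :
    searchGain μ θ ≤ searchGain μ θ' + (θ' - θ) := by
  have hd := (lipschitzWith_integral_max_sub
    (integrable_of_ae_mem_Icc hs continuous_id)).dist_le_mul θ θ'
  rw [dist_comm θ, Real.dist_eq θ', abs_of_nonneg (sub_nonneg.2 h), NNReal.coe_one, one_mul] at hd
  exact sub_le_iff_le_add'.1 ((le_abs_self _).trans hd)

lemma searchGain_of_le (hs : ∀ᵐ v ∂μ, v ∈ Icc V W) {θ : ℝ} (h : θ ≤ V) :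
    searchGain μ θ = ∫ v, v ∂μ - θ :=
  calc searchGain μ θ = ∫ v, (v - θ) ∂μ :=
        integral_congr_ae (hs.mono fun _ hv => max_eq_left (by linarith [hv.1]))
    _ = ∫ v, v ∂μ - θ := by
        rw [integral_sub (integrable_of_ae_mem_Icc hs continuous_id') (integrable_const _)]
        simp

lemma searchGain_lt_searchGain_left (hs : ∀ᵐ v ∂μ, v ∈ Icc V W) [NullSingletonClass μ] {θ : ℝ}
    (h : V < θ) : searchGain μ θ < searchGain μ V := by
  have hne : ∀ᵐ v ∂μ, v ≠ V := by simp [ae_iff]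
  have hlt : ∀ᵐ v ∂μ, max (v - θ) 0 < max (v - V) 0 := by
    filter_upwards [hs, hne] with v hv hvV
    have hVv : V < v := lt_of_le_of_ne hv.1 hvV.symm
    rw [max_eq_left (sub_nonneg.2 hVv.le)]
    exact max_lt (by linarith) (by linarith)
  refine lt_of_le_of_ne (searchGain_antitone hs h.le) fun heq => ?_
  have hae := (integral_eq_iff_of_ae_le (integrable_max_sub hs θ) (integrable_max_sub hs V)
    (hlt.mono fun _ hv => hv.le)).1 heq
  obtain ⟨v, hveq, hvlt⟩ := (hae.and hlt).exists
  exact hvlt.ne hveq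

lemma cBar_pos (hs : ∀ᵐ v ∂μ, v ∈ Icc V W) [NullSingletonClass μ] : 0 < cBar μ V :=
  (searchGain_nonneg (V + 1)).trans_lt (searchGain_lt_searchGain_left hs (lt_add_one V))

end Gain

section Index

variable {μ : Measure ℝ} [IsProbabilityMeasure μ] {V W : ℝ}

lemma theta0_le_iff (hs : ∀ᵐ v ∂μ, v ∈ Icc V W) {c θ : ℝ} (hc : 0 ≤ c) :
    theta0 μ c ≤ θ ↔ searchGain μ θ ≤ c := by
  have hbdd : BddBelow {θ : ℝ | searchGain μ θ ≤ c} := by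
    refine ⟨min V (∫ v, v ∂μ - c), fun θ (hθ : searchGain μ θ ≤ c) => ?_⟩
    rcases le_total θ V with h | h
    · rw [searchGain_of_le hs h] at hθ
      exact (min_le_right _ _).trans (by linarith)
    · exact (min_le_left _ _).trans h
  have hne : {θ : ℝ | searchGain μ θ ≤ c}.Nonempty :=
    ⟨W, (searchGain_eq_zero hs le_rfl).le.trans hc⟩
  have hmem := (isClosed_le (continuous_searchGain hs) continuous_const).csInf_mem hne hbdd
  exact ⟨fun h => (searchGain_antitone hs h).trans hmem, fun h => csInf_le hbdd h⟩

lemma lt_theta0_iff (hs : ∀ᵐ v ∂μ, v ∈ Icc V W) {c θ : ℝ} (hc : 0 ≤ c) :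
    θ < theta0 μ c ↔ c < searchGain μ θ := by
  rw [← not_le, theta0_le_iff hs hc, not_le]

lemma searchGain_theta0 (hs : ∀ᵐ v ∂μ, v ∈ Icc V W) {c : ℝ} (hc : 0 ≤ c) :
    searchGain μ (theta0 μ c) = c := by
  refine le_antisymm ((theta0_le_iff hs hc).1 le_rfl) ?_
  refine ge_of_tendsto (x := 𝓝[<] (theta0 μ c))
    ((continuous_searchGain hs).continuousAt.tendsto.mono_left nhdsWithin_le_nhds) ?_
  filter_upwards [self_mem_nhdsWithin] with θ hθ
  exact ((lt_theta0_iff hs hc).1 hθ).le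

lemma strictAntiOn_theta0 (hs : ∀ᵐ v ∂μ, v ∈ Icc V W) : StrictAntiOn (theta0 μ) (Ici 0) :=
  fun _ hc _ hd hcd => (lt_theta0_iff hs hc).2 (hcd.trans_eq (searchGain_theta0 hs hd).symm)

lemma le_theta0 (hs : ∀ᵐ v ∂μ, v ∈ Icc V W) {c : ℝ} (hc : 0 ≤ c) (h : c ≤ cBar μ V) :
    V ≤ theta0 μ c := by
  refine le_of_forall_lt fun θ hθ => (lt_theta0_iff hs hc).2 (h.trans_lt ?_)
  rw [searchGain_of_le hs hθ.le, cBar, ← searchGain, searchGain_of_le hs le_rfl]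
  linarith

lemma lt_theta0 (hs : ∀ᵐ v ∂μ, v ∈ Icc V W) {c : ℝ} (hc : 0 ≤ c) (h : c < cBar μ V) :
    V < theta0 μ c := (lt_theta0_iff hs hc).2 h

lemma theta0_cBar (hs : ∀ᵐ v ∂μ, v ∈ Icc V W) : theta0 μ (cBar μ V) = V :=
  le_antisymm ((theta0_le_iff hs (searchGain_nonneg V)).2 le_rfl)
    (le_theta0 hs (searchGain_nonneg V) le_rfl)

lemma tendsto_theta0_cBar (hs : ∀ᵐ v ∂μ, v ∈ Icc V W) [NullSingletonClass μ] :
    Tendsto (theta0 μ) (𝓝[<] (cBar μ V)) (𝓝[>] V) := by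
  have hpos : ∀ᶠ c in 𝓝[<] (cBar μ V), 0 < c := nhdsWithin_le_nhds (lt_mem_nhds (cBar_pos hs))
  have hV : ∀ᶠ c in 𝓝[<] (cBar μ V), V < theta0 μ c := by
    filter_upwards [hpos, self_mem_nhdsWithin] with c hc hcV using lt_theta0 hs hc.le hcV
  refine tendsto_nhdsWithin_iff.2 ⟨tendsto_order.2 ⟨fun θ hθ => ?_, fun θ hθ => ?_⟩, hV⟩
  · filter_upwards [hV] with c hc using hθ.trans hc
  · obtain ⟨θ', hVθ', hθ'θ⟩ := exists_between hθ
    filter_upwards [hpos, nhdsWithin_le_nhds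
      (lt_mem_nhds (searchGain_lt_searchGain_left hs hVθ'))] with c hc hcθ'
    exact ((theta0_le_iff hs hc.le).2 hcθ'.le).trans_lt hθ'θ

lemma integral_max_max_sub_of_nonpos (hs : ∀ᵐ v ∂μ, v ∈ Icc V W) (p : ℝ) {θ : ℝ} (h : θ ≤ 0) :
    ∫ v, max (max (v - p) 0 - θ) 0 ∂μ = searchGain μ p - θ := by
  have hmax (v : ℝ) : max (max (v - p) 0 - θ) 0 = max (v - p) 0 - θ :=
    max_eq_left (by linarith [le_max_right (v - p) 0])
  simp_rw [hmax]
  rw [integral_sub (integrable_max_sub hs p) (integrable_const _)]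
  simp [searchGain]

lemma weitzmanIndex_of_le_theta0 (hs : ∀ᵐ v ∂μ, v ∈ Icc V W) {p k : ℝ} (hk : 0 ≤ k)
    (hp : p ≤ theta0 μ k) : weitzmanIndex μ p k = theta0 μ k - p := by
  rw [weitzmanIndex, ← csInf_Ici (a := theta0 μ k - p)]
  congr 1 with θ
  rw [mem_ofPred_eq, mem_Ici, sub_le_iff_le_add']
  rcases le_or_gt 0 θ with h | h
  · rw [integral_max_max_sub_of_nonneg p h, theta0_le_iff hs hk]
  · rw [integral_max_max_sub_of_nonpos hs p h.le]
    have := searchGain_antitone hs hp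
    rw [searchGain_theta0 hs hk] at this
    exact iff_of_false (by linarith) (by linarith)

lemma weitzmanIndex_of_theta0_le (hs : ∀ᵐ v ∂μ, v ∈ Icc V W) {p k : ℝ} (hk : 0 ≤ k)
    (hp : theta0 μ k ≤ p) : weitzmanIndex μ p k = searchGain μ p - k := by
  have hgain := (theta0_le_iff hs hk).1 hp
  rw [weitzmanIndex, ← csInf_Ici (a := searchGain μ p - k)]
  congr 1 with θ
  rw [mem_ofPred_eq, mem_Ici]
  rcases le_or_gt θ 0 with h | h
  · rw [integral_max_max_sub_of_nonpos hs p h, sub_le_comm]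
  · rw [integral_max_max_sub_of_nonneg p h.le]
    exact iff_of_true ((searchGain_antitone hs (by linarith)).trans hgain) (by linarith)

lemma strictAntiOn_weitzmanIndex (hs : ∀ᵐ v ∂μ, v ∈ Icc V W) (p : ℝ) :
    StrictAntiOn (weitzmanIndex μ p) (Ici 0) := by
  intro k hk l hl hkl
  have hθ := strictAntiOn_theta0 hs hk hl hkl
  rcases le_total p (theta0 μ l) with hpl | hlp
  · rw [weitzmanIndex_of_le_theta0 hs hl hpl, weitzmanIndex_of_le_theta0 hs hk (hpl.trans hθ.le)]
    linarith
  rw [weitzmanIndex_of_theta0_le hs hl hlp]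
  rcases le_total p (theta0 μ k) with hpk | hkp
  · rw [weitzmanIndex_of_le_theta0 hs hk hpk]
    rcases hpk.eq_or_lt with rfl | hpk
    · rw [searchGain_theta0 hs hk]
      linarith
    · linarith [(theta0_le_iff hs hl).1 hlp]
  · rw [weitzmanIndex_of_theta0_le hs hk hkp]
    linarith

lemma theta0_sub_le_weitzmanIndex (hs : ∀ᵐ v ∂μ, v ∈ Icc V W) {p k c : ℝ} (hk : 0 ≤ k)
    (hkc : k ≤ c) : theta0 μ c - p ≤ weitzmanIndex μ p k := by
  have hθ := (strictAntiOn_theta0 hs).antitoneOn hk (hk.trans hkc) hkc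
  rcases le_total p (theta0 μ k) with hp | hp
  · rw [weitzmanIndex_of_le_theta0 hs hk hp]
    linarith
  · have hgain := searchGain_le_add hs hp
    rw [searchGain_theta0 hs hk] at hgain
    rw [weitzmanIndex_of_theta0_le hs hk hp]
    linarith

lemma weitzmanIndex_zero_nonneg (hs : ∀ᵐ v ∂μ, v ∈ Icc V W) (p : ℝ) :
    0 ≤ weitzmanIndex μ p 0 := by
  rcases le_total p (theta0 μ 0) with hp | hp
  · rw [weitzmanIndex_of_le_theta0 hs le_rfl hp]
    exact sub_nonneg.2 hp
  · rw [weitzmanIndex_of_theta0_le hs le_rfl hp, sub_zero]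
    exact searchGain_nonneg p

end Index

section Policy

variable {θ p v : Fin 2 → ℝ} {a : Fin 2}

lemma sum_eq_add_rev (φ : Fin 2 → ℝ) (a : Fin 2) : ∑ i, φ i = φ a + φ a.rev := by
  fin_cases a <;> simp [Fin.sum_univ_two, Fin.rev, add_comm]

lemma rev_ne (a : Fin 2) : a.rev ≠ a := by fin_cases a <;> decide

lemma eq_rev_of_ne {a b : Fin 2} (h : a ≠ b) : a = b.rev := by
  revert h; fin_cases a <;> fin_cases b <;> simp [Fin.rev]

lemma inspects_first : Inspects θ p v a a ↔ 0 ≤ θ a := by simp [Inspects]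

lemma inspects_rev : Inspects θ p v a a.rev ↔ 0 ≤ θ a.rev ∧ v a - p a < θ a.rev := by
  simp [Inspects, rev_ne]

lemma buys_first : Buys θ p v a a ↔ 0 ≤ θ a ∧ 0 ≤ v a - p a ∧
    (0 ≤ θ a.rev ∧ v a - p a < θ a.rev → v a.rev - p a.rev ≤ v a - p a) := by
  rw [Buys, inspects_first, ← inspects_rev (p := p)]
  refine and_congr_right fun _ => and_congr_right fun _ => ⟨fun h hi => ?_, fun h j hj hi => ?_⟩
  · rcases h a.rev (rev_ne a) hi with h | h
    exacts [h.le, h.1.le]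
  · obtain rfl := eq_rev_of_ne hj
    simpa [le_iff_lt_or_eq] using h hi

lemma buys_rev : Buys θ p v a a.rev ↔ (0 ≤ θ a.rev ∧ v a - p a < θ a.rev) ∧
    0 ≤ v a.rev - p a.rev ∧ (0 ≤ θ a → v a - p a < v a.rev - p a.rev) := by
  rw [Buys, inspects_rev, ← inspects_first (p := p) (v := v) (a := a)]
  refine and_congr_right fun _ => and_congr_right fun _ => ⟨fun h hi => ?_, fun h j hj hi => ?_⟩
  · rcases h a (rev_ne a).symm hi with h | h
    exacts [h, (rev_ne a h.2).elim]
  · obtain rfl : j = a := by simpa using eq_rev_of_ne hj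
    exact Or.inl (h hi)

lemma firstProb_nonneg (θ : Fin 2 → ℝ) (a : Fin 2) : 0 ≤ firstProb θ a := by
  unfold firstProb; split_ifs <;> norm_num

lemma firstProb_of_lt (h : θ a.rev < θ a) : firstProb θ a = 1 := by
  simp [firstProb, h]

lemma firstProb_of_gt (h : θ a < θ a.rev) : firstProb θ a = 0 := by
  simp [firstProb, h.not_gt, h.ne']

lemma sum_firstProb (θ : Fin 2 → ℝ) : ∑ a, firstProb θ a = 1 := by
  rw [sum_eq_add_rev _ 0]
  rcases lt_trichotomy (θ 0) (θ (Fin.rev 0)) with h | h | h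
  · rw [firstProb_of_gt h, firstProb_of_lt (by rwa [Fin.rev_rev]), zero_add]
  · simp only [firstProb, Fin.rev_rev, h, lt_irrefl, if_false, if_true, add_halves]
  · rw [firstProb_of_lt h, firstProb_of_gt (by rwa [Fin.rev_rev]), add_zero]

lemma sum_firstProb_mul_of_lt (h : θ a.rev < θ a) (X : Fin 2 → ℝ) :
    ∑ b, firstProb θ b * X b = X a := by
  rw [sum_eq_add_rev _ a, firstProb_of_lt h, firstProb_of_gt (by rwa [Fin.rev_rev]), one_mul,
    zero_mul, add_zero]

lemma sum_firstProb_mul_le {X : Fin 2 → ℝ} {r : ℝ} (h : ∀ a, firstProb θ a ≠ 0 → X a ≤ r) :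
    ∑ a, firstProb θ a * X a ≤ r := by
  rw [← one_mul r, ← sum_firstProb θ, Finset.sum_mul]
  refine Finset.sum_le_sum fun a _ => ?_
  rcases (firstProb_nonneg θ a).eq_or_lt with h0 | h0
  · rw [← h0, zero_mul, zero_mul]
  · exact mul_le_mul_of_nonneg_left (h a h0.ne') h0.le

lemma le_sum_firstProb_mul {X : Fin 2 → ℝ} {r : ℝ} (h : ∀ a, firstProb θ a ≠ 0 → r ≤ X a) :
    r ≤ ∑ a, firstProb θ a * X a := by
  have := sum_firstProb_mul_le (X := fun a => -X a) fun a ha => neg_le_neg (h a ha)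
  simpa only [mul_neg, Finset.sum_neg_distrib, neg_le_neg_iff] using this

lemma sum_firstProb_mul_eq {X : Fin 2 → ℝ} {r : ℝ} (h : ∀ a, firstProb θ a ≠ 0 → X a = r) :
    ∑ a, firstProb θ a * X a = r :=
  le_antisymm (sum_firstProb_mul_le fun a ha => (h a ha).le)
    (le_sum_firstProb_mul fun a ha => (h a ha).ge)

lemma average_eq_sum {c : ℝ} {x : Fin 2 → ℝ} (hx : ∑ w, x w = 1) (g : (Fin 2 → ℝ) → ℝ) :
    average c x g = ∑ w, x w * g (prominentCosts c w) := by
  simp [average, hx]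

lemma average_eq {c : ℝ} {x : Fin 2 → ℝ} (hx : ∑ w, x w = 1) {g : (Fin 2 → ℝ) → ℝ} {r : ℝ}
    (h : ∀ w, g (prominentCosts c w) = r) : average c x g = r := by
  simp_rw [average_eq_sum hx, h, ← Finset.sum_mul, hx, one_mul]

lemma le_average {c : ℝ} {x : Fin 2 → ℝ} (hx : ∀ i, 0 ≤ x i) (hx1 : ∑ i, x i ≤ 1)
    {g : (Fin 2 → ℝ) → ℝ} {r : ℝ} (h : ∀ w, r ≤ g (prominentCosts c w))
    (h' : r ≤ g fun _ => c) : r ≤ average c x g :=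
  calc r = ∑ w, x w * r + (1 - ∑ w, x w) * r := by rw [← Finset.sum_mul]; ring
    _ ≤ average c x g := by
        unfold average
        gcongr with w
        exacts [hx w, h w]

lemma average_le {c : ℝ} {x : Fin 2 → ℝ} (hx : ∀ i, 0 ≤ x i) (hx1 : ∑ i, x i = 1)
    {g : (Fin 2 → ℝ) → ℝ} {r : ℝ} (h : ∀ w, g (prominentCosts c w) ≤ r) : average c x g ≤ r :=
  calc average c x g = ∑ w, x w * g (prominentCosts c w) := average_eq_sum hx1 g
    _ ≤ ∑ w, x w * r := by
        gcongr with w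
        exacts [hx w, h w]
    _ = r := by rw [← Finset.sum_mul, hx1, one_mul]

lemma prominentCosts_self (c : ℝ) (w : Fin 2) : prominentCosts c w w = 0 := by
  simp [prominentCosts]

lemma prominentCosts_rev (c : ℝ) (w : Fin 2) : prominentCosts c w w.rev = c := by
  simp [prominentCosts, rev_ne]

lemma prominentCosts_mem_Icc {c : ℝ} (hc : 0 ≤ c) (w i : Fin 2) :
    prominentCosts c w i ∈ Icc 0 c := by
  unfold prominentCosts; split_ifs <;> simp [hc]

end Policy

section Payoff

instance (μ : Measure ℝ) [IsProbabilityMeasure μ] : IsProbabilityMeasure (valueLaw μ) := by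
  unfold valueLaw; infer_instance

lemma ae_prod_mem_Icc {μ : Measure ℝ} [IsFiniteMeasure μ] {V W : ℝ}
    (hs : ∀ᵐ v ∂μ, v ∈ Icc V W) :
    ∀ᵐ z ∂(μ.prod μ), z ∈ Icc V W ×ˢ Icc V W :=
  (Measure.quasiMeasurePreserving_fst.ae hs).and (Measure.quasiMeasurePreserving_snd.ae hs)

variable {μ : Measure ℝ} [IsProbabilityMeasure μ] {V W : ℝ}

lemma measurePreserving_pair (o : Fin 2) :
    MeasurePreserving (fun v : Fin 2 → ℝ => (v o, v o.rev)) (valueLaw μ) (μ.prod μ) := by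
  have h := measurePreserving_piFinTwo (fun _ : Fin 2 => μ)
  fin_cases o
  · exact h
  · exact Measure.measurePreserving_swap.comp h

lemma ae_valueLaw {P : ℝ → Prop} (h : ∀ᵐ v ∂μ, P v) : ∀ᵐ v ∂(valueLaw μ), ∀ i, P (v i) :=
  ae_all_iff.2 fun i => (Measure.quasiMeasurePreserving_eval (fun _ : Fin 2 => μ) i).ae h

open Classical in
/-- The payoff of a search that finds the value `z.1` first, at no cost, and also finds `z.2`, at
cost `c`, if `z.1 ∈ S`, when `φ v` is what a best value `v` is worth. -/
noncomputable def searchPayoff (φ : ℝ → ℝ) (S : Set ℝ) (c : ℝ) : ℝ × ℝ → ℝ :=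
  (Prod.fst ⁻¹' S).piecewise (fun z => φ (max z.1 z.2) - c) fun z => φ z.1

lemma searchPayoff_of_mem {φ : ℝ → ℝ} {S : Set ℝ} {c : ℝ} {z : ℝ × ℝ} (h : z.1 ∈ S) :
    searchPayoff φ S c z = φ (max z.1 z.2) - c := if_pos h

lemma searchPayoff_of_notMem {φ : ℝ → ℝ} {S : Set ℝ} {c : ℝ} {z : ℝ × ℝ} (h : z.1 ∉ S) :
    searchPayoff φ S c z = φ z.1 := if_neg h

lemma searchPayoff_mono {φ ψ : ℝ → ℝ} (S : Set ℝ) (c : ℝ) {z : ℝ × ℝ}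
    (h₁ : φ z.1 ≤ ψ z.1) (h₂ : φ z.2 ≤ ψ z.2) : searchPayoff φ S c z ≤ searchPayoff ψ S c z := by
  have hmax : φ (max z.1 z.2) ≤ ψ (max z.1 z.2) := max_rec' (fun x => φ x ≤ ψ x) h₁ h₂
  by_cases hz : z.1 ∈ S
  · simpa only [searchPayoff_of_mem hz] using sub_le_sub_right hmax c
  · simpa only [searchPayoff_of_notMem hz] using h₁

lemma searchPayoff_congr {φ ψ : ℝ → ℝ} (S : Set ℝ) (c : ℝ) {z : ℝ × ℝ}
    (h₁ : φ z.1 = ψ z.1) (h₂ : φ z.2 = ψ z.2) : searchPayoff φ S c z = searchPayoff ψ S c z :=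
  le_antisymm (searchPayoff_mono S c h₁.le h₂.le) (searchPayoff_mono S c h₁.ge h₂.ge)

lemma searchPayoff_sub (r : ℝ) (S : Set ℝ) (c : ℝ) (z : ℝ × ℝ) :
    searchPayoff (fun x => x - r) S c z = searchPayoff id S c z - r := by
  by_cases hz : z.1 ∈ S
  · simp only [searchPayoff_of_mem hz, id_eq, sub_right_comm]
  · simp only [searchPayoff_of_notMem hz, id_eq]

lemma integrable_searchPayoff (hs : ∀ᵐ v ∂μ, v ∈ Icc V W) {φ : ℝ → ℝ} (hφ : Continuous φ)
    {S : Set ℝ} (hS : MeasurableSet S) (c : ℝ) : Integrable (searchPayoff φ S c) (μ.prod μ) := by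
  have hint {H : ℝ × ℝ → ℝ} (hH : Continuous H) : Integrable H (μ.prod μ) :=
    integrable_of_ae_mem_isCompact (isCompact_Icc.prod isCompact_Icc) (ae_prod_mem_Icc hs) hH
  classical
  exact Integrable.piecewise (measurable_fst hS)
    (hint (H := fun z => φ (max z.1 z.2) - c) (by fun_prop)).integrableOn
    (hint (H := fun z => φ z.1) (by fun_prop)).integrableOn

lemma integral_searchPayoff_id (hs : ∀ᵐ v ∂μ, v ∈ Icc V W) {S : Set ℝ} (hS : MeasurableSet S)
    (c : ℝ) : ∫ z, searchPayoff id S c z ∂(μ.prod μ) =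
      ∫ v, v ∂μ + ∫ v, S.indicator (fun v => searchGain μ v - c) v ∂μ := by
  have hgain : Integrable (fun v => searchGain μ v - c) μ :=
    integrable_of_ae_mem_Icc hs ((continuous_searchGain hs).sub continuous_const)
  rw [integral_prod _ (integrable_searchPayoff hs continuous_id hS c),
    ← integral_add (integrable_of_ae_mem_Icc hs continuous_id') (hgain.indicator hS)]
  refine integral_congr_ae (ae_of_all _ fun s => ?_)
  by_cases h : s ∈ S
  · have hmax (v : ℝ) : searchPayoff id S c (s, v) = max (v - s) 0 + (s - c) := by
      rw [searchPayoff_of_mem h, id_eq, max_comm, ← sub_add_cancel (max v s) s,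
        ← max_sub_sub_right, sub_self, add_sub_assoc]
    simp only [hmax, indicator_of_mem h]
    rw [integral_add (integrable_max_sub hs s) (integrable_const _), ← searchGain]
    simp only [integral_const, probReal_univ, one_smul]
    ring
  · have hfst (v : ℝ) : searchPayoff id S c (s, v) = s := searchPayoff_of_notMem h
    simp [hfst, h]

/-- The expected welfare of a buyer who finds a first value for free and may inspect a second one
at cost `c`. -/
noncomputable def searchWelfare (μ : Measure ℝ) (c : ℝ) : ℝ :=
  ∫ v, v ∂μ + ∫ v, max (searchGain μ v - c) 0 ∂μ

lemma integrable_max_searchGain_sub (hs : ∀ᵐ v ∂μ, v ∈ Icc V W) (c : ℝ) :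
    Integrable (fun v => max (searchGain μ v - c) 0) μ :=
  integrable_of_ae_mem_Icc hs
    (((continuous_searchGain hs).sub continuous_const).max continuous_const)

lemma integral_searchPayoff_id_le (hs : ∀ᵐ v ∂μ, v ∈ Icc V W) {S : Set ℝ}
    (hS : MeasurableSet S) (c : ℝ) :
    ∫ z, searchPayoff id S c z ∂(μ.prod μ) ≤ searchWelfare μ c := by
  have hgain : Integrable (fun v => searchGain μ v - c) μ :=
    integrable_of_ae_mem_Icc hs ((continuous_searchGain hs).sub continuous_const)
  rw [integral_searchPayoff_id hs hS]
  refine add_le_add_right (integral_mono (hgain.indicator hS)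
    (integrable_max_searchGain_sub hs c) ?_) _
  exact indicator_le' (fun _ _ => le_max_left _ _) fun _ _ => le_max_right _ _

lemma integral_searchPayoff_id_Iio_theta0 (hs : ∀ᵐ v ∂μ, v ∈ Icc V W) {c : ℝ} (hc : 0 ≤ c) :
    ∫ z, searchPayoff id (Iio (theta0 μ c)) c z ∂(μ.prod μ) = searchWelfare μ c := by
  rw [integral_searchPayoff_id hs measurableSet_Iio, searchWelfare]
  congr 2 with v
  by_cases h : v < theta0 μ c
  · rw [indicator_of_mem (mem_Iio.2 h),
      max_eq_left (sub_nonneg.2 ((lt_theta0_iff hs hc).1 h).le)]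
  · rw [indicator_of_notMem (notMem_Iio.2 (not_lt.1 h)),
      max_eq_right (sub_nonpos.2 ((theta0_le_iff hs hc).1 (not_lt.1 h)))]

lemma continuous_searchWelfare (hs : ∀ᵐ v ∂μ, v ∈ Icc V W) : Continuous (searchWelfare μ) :=
  continuous_const.add (lipschitzWith_integral_max_sub
    (integrable_of_ae_mem_Icc hs (continuous_searchGain hs))).continuous

lemma searchWelfare_cBar (hs : ∀ᵐ v ∂μ, v ∈ Icc V W) :
    searchWelfare μ (cBar μ V) = ∫ v, v ∂μ := by
  refine (add_eq_left (a := ∫ v, v ∂μ)).2 (integral_eq_zero_of_ae ?_)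
  exact hs.mono fun v hv => max_eq_right (sub_nonpos.2 (searchGain_antitone hs hv.1))

end Payoff

section Surplus

/-- The values at which the buyer goes on to inspect a second seller of price `t` and inspection
cost `c`, when the first one asks for `t` too. -/
def continuationSet (μ : Measure ℝ) (t c : ℝ) : Set ℝ :=
  {s | 0 ≤ weitzmanIndex μ t c ∧ s - t < weitzmanIndex μ t c}

lemma measurableSet_continuationSet (μ : Measure ℝ) (t c : ℝ) :
    MeasurableSet (continuationSet μ t c) :=
  (MeasurableSet.const _).inter
    (measurableSet_lt (f := fun s => s - t) (by fun_prop) measurable_const)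

lemma sum_payoff_eq_searchPayoff {θ k v : Fin 2 → ℝ} {a : Fin 2} (ha : 0 ≤ θ a) (t : ℝ)
    (φ : ℝ → ℝ) :
    ∑ i, ({v | Buys θ (fun _ => t) v a i}.indicator (fun v => φ (v i)) v
      - {v | Inspects θ (fun _ => t) v a i}.indicator (fun _ => k i) v) =
    searchPayoff ((Ici t).indicator φ) {s | 0 ≤ θ a.rev ∧ s - t < θ a.rev} (k a.rev)
      (v a, v a.rev) - k a := by
  rw [sum_eq_add_rev _ a]
  simp only [indicator, mem_ofPred_eq, inspects_first, inspects_rev, buys_first, buys_rev, ha,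
    forall_const, true_and, sub_nonneg, sub_le_sub_iff_right, sub_lt_sub_iff_right, if_true]
  by_cases hS : 0 ≤ θ a.rev ∧ v a - t < θ a.rev
  · rw [searchPayoff_of_mem hS]
    simp only [hS, and_self, forall_const, true_and, if_true, indicator, mem_Ici]
    rcases le_or_gt (v a.rev) (v a) with hle | hlt
    · simp only [hle, hle.not_gt, max_eq_left, and_true, and_false, if_false]
      ring
    · simp only [hlt, hlt.not_ge, max_eq_right hlt.le, and_true, and_false, if_false]
      ring
  · rw [searchPayoff_of_notMem hS]
    simp only [hS, false_imp_iff, false_and, and_true, if_false, indicator, mem_Ici]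
    ring

variable {μ : Measure ℝ} [IsProbabilityMeasure μ] {V W : ℝ}

lemma indices_rev_lt (hs : ∀ᵐ v ∂μ, v ∈ Icc V W) {c : ℝ} (hc : 0 < c) (t : ℝ) (w : Fin 2) :
    indices μ (fun _ => t) (prominentCosts c w) w.rev <
      indices μ (fun _ => t) (prominentCosts c w) w := by
  rw [indices, indices, prominentCosts_self, prominentCosts_rev]
  exact strictAntiOn_weitzmanIndex hs t self_mem_Ici hc.le hc

lemma eq_of_firstProb_ne_zero (hs : ∀ᵐ v ∂μ, v ∈ Icc V W) {c t : ℝ} (hc : 0 < c) {w a : Fin 2}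
    (h : firstProb (indices μ (fun _ => t) (prominentCosts c w)) a ≠ 0) : a = w := by
  by_contra haw
  obtain rfl := eq_rev_of_ne haw
  refine h (firstProb_of_gt ?_)
  rw [Fin.rev_rev]
  exact indices_rev_lt hs hc t w

lemma prominentCosts_of_firstProb_ne_zero (hs : ∀ᵐ v ∂μ, v ∈ Icc V W) {c t : ℝ} (hc : 0 ≤ c)
    {w a : Fin 2} (h : firstProb (indices μ (fun _ => t) (prominentCosts c w)) a ≠ 0) :
    prominentCosts c w a = 0 ∧ prominentCosts c w a.rev = c := by
  rcases hc.eq_or_lt with rfl | hc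
  · simp [prominentCosts]
  · obtain rfl := eq_of_firstProb_ne_zero hs hc h
    exact ⟨prominentCosts_self _ _, prominentCosts_rev _ _⟩

lemma integral_sum_payoff (hs : ∀ᵐ v ∂μ, v ∈ Icc V W) {c t : ℝ} (hc : 0 ≤ c) {w a : Fin 2}
    (h : firstProb (indices μ (fun _ => t) (prominentCosts c w)) a ≠ 0) {φ ψ : ℝ → ℝ}
    (hψ : Continuous ψ) (hφψ : ∀ᵐ x ∂μ, (Ici t).indicator φ x = ψ x) :
    ∫ v, ∑ i, ({v | Buys (indices μ (fun _ => t) (prominentCosts c w)) (fun _ => t) v a i}.indicator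
        (fun v => φ (v i)) v
      - {v | Inspects (indices μ (fun _ => t) (prominentCosts c w)) (fun _ => t) v a i}.indicator
        (fun _ => prominentCosts c w i) v) ∂(valueLaw μ) =
    ∫ z, searchPayoff ψ (continuationSet μ t c) c z ∂(μ.prod μ) := by
  obtain ⟨hfirst, hrev⟩ := prominentCosts_of_firstProb_ne_zero hs hc h
  have ha : 0 ≤ indices μ (fun _ => t) (prominentCosts c w) a := by
    rw [indices, hfirst]
    exact weitzmanIndex_zero_nonneg hs t
  have hmeas := (integrable_searchPayoff hs hψ (measurableSet_continuationSet μ t c) c).1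
  have hpair := measurePreserving_pair (μ := μ) a
  rw [← hpair.map_eq] at hmeas ⊢
  rw [integral_map hpair.measurable.aemeasurable hmeas]
  refine integral_congr_ae ((ae_valueLaw hφψ).mono fun v hv => ?_)
  simp only [sum_payoff_eq_searchPayoff ha, hfirst, hrev, sub_zero]
  rw [indices, hrev]
  exact searchPayoff_congr _ _ (hv a) (hv a.rev)

lemma continuationSet_of_le (hs : ∀ᵐ v ∂μ, v ∈ Icc V W) {c t : ℝ} (hc : 0 ≤ c)
    (ht : t ≤ theta0 μ c) : continuationSet μ t c = Iio (theta0 μ c) := by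
  ext s
  rw [continuationSet, weitzmanIndex_of_le_theta0 hs hc ht, mem_ofPred_eq, sub_lt_sub_iff_right,
    and_iff_right (sub_nonneg.2 ht), mem_Iio]

lemma integral_searchPayoff_sub (hs : ∀ᵐ v ∂μ, v ∈ Icc V W) {S : Set ℝ} (hS : MeasurableSet S)
    (r c : ℝ) : ∫ z, searchPayoff (fun x => x - r) S c z ∂(μ.prod μ) =
      ∫ z, searchPayoff id S c z ∂(μ.prod μ) - r := by
  simp_rw [searchPayoff_sub]
  rw [integral_sub (integrable_searchPayoff hs continuous_id hS c) (integrable_const r)]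
  simp

lemma expectedWelfare_eq (hs : ∀ᵐ v ∂μ, v ∈ Icc V W) {c t : ℝ} (hc : c ∈ Icc 0 (cBar μ V))
    (ht : t ≤ V) (w : Fin 2) :
    expectedWelfare μ (fun _ => t) (prominentCosts c w) = searchWelfare μ c := by
  refine sum_firstProb_mul_eq fun a ha => ?_
  have hφ : ∀ᵐ x ∂μ, (Ici t).indicator id x = id x :=
    hs.mono fun x hx => indicator_of_mem (ht.trans hx.1) _
  refine (integral_sum_payoff hs hc.1 ha continuous_id hφ).trans ?_
  rw [continuationSet_of_le hs hc.1 (ht.trans (le_theta0 hs hc.1 hc.2)),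
    integral_searchPayoff_id_Iio_theta0 hs hc.1]

lemma buyerUtility_eq (hs : ∀ᵐ v ∂μ, v ∈ Icc V W) {c t : ℝ} (hc : c ∈ Icc 0 (cBar μ V))
    (ht : t ≤ V) (w : Fin 2) :
    buyerUtility μ (fun _ => t) (prominentCosts c w) = searchWelfare μ c - t := by
  refine sum_firstProb_mul_eq fun a ha => ?_
  have hφ : ∀ᵐ x ∂μ, (Ici t).indicator (fun x => x - t) x = x - t :=
    hs.mono fun x hx => indicator_of_mem (mem_Ici.2 (ht.trans hx.1)) _
  refine (integral_sum_payoff hs hc.1 ha (by fun_prop) hφ).trans ?_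
  rw [continuationSet_of_le hs hc.1 (ht.trans (le_theta0 hs hc.1 hc.2)),
    integral_searchPayoff_sub hs measurableSet_Iio, integral_searchPayoff_id_Iio_theta0 hs hc.1]

lemma buyerUtility_le (hs : ∀ᵐ v ∂μ, v ∈ Icc V W) {c t : ℝ} (hc : 0 ≤ c) (ht : V ≤ t)
    (w : Fin 2) : buyerUtility μ (fun _ => t) (prominentCosts c w) ≤ searchWelfare μ c - V := by
  refine sum_firstProb_mul_le fun a ha => ?_
  have hS := measurableSet_continuationSet μ t c
  have hφ (x : ℝ) : (Ici t).indicator (fun x => x - t) x = max (x - t) 0 := by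
    rcases le_or_gt t x with h | h
    · rw [indicator_of_mem (mem_Ici.2 h), max_eq_left (sub_nonneg.2 h)]
    · rw [indicator_of_notMem (notMem_Ici.2 h), max_eq_right (sub_nonpos.2 h.le)]
  calc _ = ∫ z, searchPayoff (fun x => max (x - t) 0) (continuationSet μ t c) c z ∂(μ.prod μ) :=
        integral_sum_payoff hs hc ha (by fun_prop) (ae_of_all _ hφ)
    _ ≤ ∫ z, searchPayoff (fun x => x - V) (continuationSet μ t c) c z ∂(μ.prod μ) := by
        refine integral_mono_ae (integrable_searchPayoff hs (by fun_prop) hS c)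
          (integrable_searchPayoff hs (by fun_prop) hS c) ((ae_prod_mem_Icc hs).mono fun z hz => ?_)
        exact searchPayoff_mono _ _ (max_le (by linarith) (sub_nonneg.2 hz.1.1))
          (max_le (by linarith) (sub_nonneg.2 hz.2.1))
    _ ≤ searchWelfare μ c - V := by
        rw [integral_searchPayoff_sub hs hS]
        exact sub_le_sub_right (integral_searchPayoff_id_le hs hS c) V

end Surplus

section Demand

/-- The probability of a purchase from the second of two sellers in the order of search, who asks
for `x` more than the first one, and whose index is `θ` minus their price. -/
noncomputable def secondDemand (μ : Measure ℝ) (θ x : ℝ) : ℝ :=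
  (μ.prod μ).real {z | z.1 + x < θ ∧ z.1 + x < z.2}

lemma measurableSet_secondDemand (θ x : ℝ) :
    MeasurableSet {z : ℝ × ℝ | z.1 + x < θ ∧ z.1 + x < z.2} :=
  (measurableSet_lt (f := fun z : ℝ × ℝ => z.1 + x) (by fun_prop) measurable_const).inter
    (measurableSet_lt (f := fun z : ℝ × ℝ => z.1 + x) (by fun_prop) measurable_snd)

lemma buys_second {θ p v : Fin 2 → ℝ} {i : Fin 2} : Buys θ p v i.rev i ↔
    (0 ≤ θ i ∧ v i.rev - p i.rev < θ i) ∧ 0 ≤ v i - p i ∧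
      (0 ≤ θ i.rev → v i.rev - p i.rev < v i - p i) := by
  simpa only [Fin.rev_rev] using buys_rev (θ := θ) (p := p) (v := v) (a := i.rev)

variable {μ : Measure ℝ}

lemma secondDemand_nonneg (θ x : ℝ) : 0 ≤ secondDemand μ θ x := measureReal_nonneg

lemma purchaseProb_of_lt {p k : Fin 2 → ℝ} {a : Fin 2}
    (h : indices μ p k a.rev < indices μ p k a) (i : Fin 2) :
    purchaseProb μ p k i = (valueLaw μ).real {v | Buys (indices μ p k) p v a i} :=
  sum_firstProb_mul_of_lt h _

variable [IsProbabilityMeasure μ] {V W : ℝ}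

lemma secondDemand_eq_valueLaw (i : Fin 2) (θ x : ℝ) : secondDemand μ θ x =
    (valueLaw μ).real {v | v i.rev + x < θ ∧ v i.rev + x < v i} := by
  have h := (measurePreserving_pair (μ := μ) i.rev).measureReal_preimage
    (measurableSet_secondDemand θ x).nullMeasurableSet
  rw [Fin.rev_rev] at h
  exact h.symm

lemma secondDemand_mono {θ θ' : ℝ} (h : θ ≤ θ') (x : ℝ) :
    secondDemand μ θ x ≤ secondDemand μ θ' x :=
  measureReal_mono fun _ hz => ⟨hz.1.trans_le h, hz.2⟩

lemma one_sub_cdf (y : ℝ) : 1 - cdf μ y = μ.real (Ioi y) := by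
  rw [cdf_eq_real, ← compl_Iic, probReal_compl_eq_one_sub measurableSet_Iic]

lemma secondDemand_le_cdf (θ x : ℝ) : secondDemand μ θ x ≤ cdf μ (θ - x) := by
  have hfst := (measurePreserving_fst (μ := μ) (ν := μ)).measureReal_preimage
    (measurableSet_Iic (a := θ - x)).nullMeasurableSet
  rw [cdf_eq_real, ← hfst]
  exact measureReal_mono fun z hz => (lt_sub_iff_add_lt.2 hz.1).le

lemma secondDemand_eq_zero (hs : ∀ᵐ v ∂μ, v ∈ Icc V W) {θ x : ℝ} (h : θ - V ≤ x) :
    secondDemand μ θ x = 0 := by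
  rw [secondDemand, measureReal_def, measure_eq_zero_iff_ae_notMem.2, ENNReal.toReal_zero]
  filter_upwards [ae_prod_mem_Icc hs] with z hz hz'
  exact hz'.1.not_ge (by linarith [hz.1.1])

lemma secondDemand_eq_integral (θ x : ℝ) :
    secondDemand μ θ x = ∫ s, (Iio (θ - x)).indicator (fun s => 1 - cdf μ (s + x)) s ∂μ := by
  have hmeas := measurableSet_secondDemand θ x
  rw [secondDemand, measureReal_def, Measure.prod_apply hmeas,
    ← integral_toReal (measurable_measure_prodMk_left hmeas).aemeasurable
      (ae_of_all _ fun _ => measure_lt_top _ _)]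
  refine integral_congr_ae (ae_of_all _ fun s => ?_)
  by_cases h : s + x < θ
  · simp [h, lt_sub_iff_add_lt, one_sub_cdf, measureReal_def, Ioi]
  · simp [h, lt_sub_iff_add_lt]

lemma deviationDemand_eq (hs : ∀ᵐ v ∂μ, v ∈ Icc V W) [NullSingletonClass μ] (c x : ℝ) :
    deviationDemand μ V c x = secondDemand μ (theta0 μ c) x := by
  unfold deviationDemand
  split_ifs with h
  · rw [secondDemand_eq_integral, integral_indicator measurableSet_Iio]
    refine setIntegral_congr_set ?_
    have hne : ∀ᵐ v ∂μ, v ≠ theta0 μ c - x := by simp [ae_iff]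
    filter_upwards [hs, hne] with v hv hne
    exact propext ⟨fun h => lt_of_le_of_ne h.2 hne, fun h => ⟨hv.1, le_of_lt h⟩⟩
  · exact (secondDemand_eq_zero hs (not_lt.1 h)).symm

lemma indices_eq_theta0_sub (hs : ∀ᵐ v ∂μ, v ∈ Icc V W) {k p : Fin 2 → ℝ} {i : Fin 2}
    (hk : k i ∈ Icc 0 (cBar μ V)) (hp : p i ≤ V) : indices μ p k i = theta0 μ (k i) - p i :=
  weitzmanIndex_of_le_theta0 hs hk.1 (hp.trans (le_theta0 hs hk.1 hk.2))

lemma purchaseProb_prominent (hs : ∀ᵐ v ∂μ, v ∈ Icc V W) {c t : ℝ} (hc : c ∈ Ioc 0 (cBar μ V))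
    (ht : t ≤ V) (w : Fin 2) :
    purchaseProb μ (fun _ => t) (prominentCosts c w) w = 1 - secondDemand μ (theta0 μ c) 0 ∧
      purchaseProb μ (fun _ => t) (prominentCosts c w) w.rev = secondDemand μ (theta0 μ c) 0 := by
  have hlt := indices_rev_lt hs hc.1 t w
  have hrev : indices μ (fun _ => t) (prominentCosts c w) w.rev = theta0 μ c - t := by
    rw [indices_eq_theta0_sub hs ((prominentCosts_rev c w).symm ▸ Ioc_subset_Icc_self hc) ht,
      prominentCosts_rev]
  have hrev0 : 0 ≤ theta0 μ c - t := sub_nonneg.2 (ht.trans (le_theta0 hs hc.1.le hc.2))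
  have hw0 := (hrev0.trans hrev.ge).trans hlt.le
  have hsecond : ∀ᵐ v ∂(valueLaw μ),
      Buys (indices μ (fun _ => t) (prominentCosts c w)) (fun _ => t) v w w.rev ↔
        (v w, v w.rev) ∈ {z : ℝ × ℝ | z.1 + 0 < theta0 μ c ∧ z.1 + 0 < z.2} := by
    filter_upwards [ae_valueLaw hs] with v hv
    simp [buys_rev, hw0, hrev, hrev0, ht.trans (hv w.rev).1]
  have hfirst : ∀ᵐ v ∂(valueLaw μ),
      Buys (indices μ (fun _ => t) (prominentCosts c w)) (fun _ => t) v w w ↔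
        (v w, v w.rev) ∈ {z : ℝ × ℝ | z.1 + 0 < theta0 μ c ∧ z.1 + 0 < z.2}ᶜ := by
    filter_upwards [ae_valueLaw hs] with v hv
    simp [buys_first, hw0, hrev, hrev0, ht.trans (hv w).1]
  have hmeas := measurableSet_secondDemand (theta0 μ c) 0
  have hpair := measurePreserving_pair (μ := μ) w
  rw [purchaseProb_of_lt hlt, purchaseProb_of_lt hlt, secondDemand,
    ← probReal_compl_eq_one_sub hmeas, ← hpair.measureReal_preimage hmeas.nullMeasurableSet,
    ← hpair.measureReal_preimage hmeas.compl.nullMeasurableSet]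
  exact ⟨measureReal_congr (hfirst.mono fun _ h => propext h),
    measureReal_congr (hsecond.mono fun _ h => propext h)⟩

lemma average_half_purchaseProb (hs : ∀ᵐ v ∂μ, v ∈ Icc V W) {c t : ℝ}
    (hc : c ∈ Ioc 0 (cBar μ V)) (ht : t ≤ V) (i : Fin 2) :
    average c (fun _ => 1 / 2) (fun k => purchaseProb μ (fun _ => t) k i) = 1 / 2 := by
  have hrev := (purchaseProb_prominent hs hc ht i.rev).2
  rw [Fin.rev_rev] at hrev
  rw [average_eq_sum (by norm_num), sum_eq_add_rev _ i, (purchaseProb_prominent hs hc ht i).1,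
    hrev]
  ring

lemma secondDemand_le_purchaseProb (hs : ∀ᵐ v ∂μ, v ∈ Icc V W) {c x : ℝ} {p k : Fin 2 → ℝ}
    {i : Fin 2} (hrev : p i.rev ≤ V) (hi : p i = p i.rev + x) (hk : k i ∈ Icc 0 c) :
    secondDemand μ (theta0 μ c) x ≤ purchaseProb μ p k i := by
  have hindex : theta0 μ c - p i ≤ indices μ p k i := theta0_sub_le_weitzmanIndex hs hk.1 hk.2
  refine le_sum_firstProb_mul fun a _ => ?_
  rw [secondDemand_eq_valueLaw i]
  refine ENNReal.toReal_mono (measure_ne_top _ _) (measure_mono_ae ?_)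
  filter_upwards [ae_valueLaw hs] with v hv ⟨hθ, hlt⟩
  have hrevV := (hv i.rev).1
  by_cases hai : a = i
  · subst hai
    exact buys_first.2 ⟨by linarith, by linarith, fun _ => by linarith⟩
  · obtain rfl := eq_rev_of_ne hai
    exact buys_second.2 ⟨⟨by linarith, by linarith⟩, by linarith, fun _ => by linarith⟩

lemma purchaseProb_le_secondDemand (hs : ∀ᵐ v ∂μ, v ∈ Icc V W) {c x : ℝ}
    (hc : c ∈ Ioc 0 (cBar μ V)) {p : Fin 2 → ℝ} {i : Fin 2} (hrev : p i.rev ≤ V)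
    (hi : p i = p i.rev + x) (hx : theta0 μ c - x < theta0 μ 0) :
    purchaseProb μ p (prominentCosts c i.rev) i ≤ secondDemand μ (theta0 μ c) x := by
  have hcBar := hc.1.le.trans hc.2
  have hfirst : indices μ p (prominentCosts c i.rev) i.rev = theta0 μ 0 - p i.rev := by
    rw [indices_eq_theta0_sub hs (by simp [prominentCosts_self, hcBar]) hrev, prominentCosts_self]
  have hki : prominentCosts c i.rev i = c := by simpa using prominentCosts_rev c i.rev
  -- above the price `θ₀(c)` the index is no longer `θ₀(c) - p i`, but it is not positive either
  have hsecond : indices μ p (prominentCosts c i.rev) i ≤ 0 ∨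
      indices μ p (prominentCosts c i.rev) i = theta0 μ c - p i := by
    rw [indices, hki]
    rcases le_total (p i) (theta0 μ c) with h | h
    · exact Or.inr (weitzmanIndex_of_le_theta0 hs hc.1.le h)
    · rw [weitzmanIndex_of_theta0_le hs hc.1.le h]
      exact Or.inl (sub_nonpos.2 ((theta0_le_iff hs hc.1.le).1 h))
  have hθ := le_theta0 hs hc.1.le hc.2
  have hθlt := strictAntiOn_theta0 hs self_mem_Ici hc.1.le hc.1
  have hlt : indices μ p (prominentCosts c i.rev) i.rev.rev <
      indices μ p (prominentCosts c i.rev) i.rev := by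
    rw [Fin.rev_rev, hfirst]
    rcases hsecond with h | h <;> linarith
  rw [purchaseProb_of_lt hlt, secondDemand_eq_valueLaw i]
  refine ENNReal.toReal_mono (measure_ne_top _ _) (measure_mono_ae ?_)
  filter_upwards [ae_valueLaw hs] with v hv hbuys
  obtain ⟨⟨-, hcont⟩, -, hbest⟩ := buys_second.1 hbuys
  have hrevV := (hv i.rev).1
  have hbest := hbest (by linarith)
  rw [hsecond.resolve_left (by linarith)] at hcont
  exact ⟨by linarith, by linarith⟩

end Demand

section LowestPrice

lemma one_le_card_mul_measureReal_eq {α β : Type*} [MeasurableSpace α] [MeasurableSpace β]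
    [MeasurableSingletonClass β] {μ : Measure α} [IsProbabilityMeasure μ] {κ : α → β}
    (hκ : Measurable κ) (J : Finset β) (hJ : ∀ᵐ v ∂μ, κ v ∈ J) :
    1 ≤ J.card * (μ.prod μ).real {z | κ z.1 = κ z.2} := by
  have hmeas (j : β) : MeasurableSet (κ ⁻¹' {j}) := hκ (measurableSet_singleton j)
  have hdisj {i j : β} (hij : i ≠ j) : Disjoint (κ ⁻¹' {i}) (κ ⁻¹' {j}) :=
    Disjoint.preimage κ (disjoint_singleton.2 hij)
  have hsum : ∑ j ∈ J, μ.real (κ ⁻¹' {j}) = 1 := by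
    rw [← measureReal_biUnion_finset (fun i _ j _ hij => hdisj hij) fun j _ => hmeas j,
      measureReal_congr (t := univ) (eventuallyEq_univ.2 ?_), probReal_univ]
    exact hJ.mono fun v hv => mem_biUnion hv rfl
  have hsq : ∑ j ∈ J, μ.real (κ ⁻¹' {j}) ^ 2 ≤ (μ.prod μ).real {z | κ z.1 = κ z.2} := by
    have hsub : ⋃ j ∈ J, (κ ⁻¹' {j}) ×ˢ (κ ⁻¹' {j}) ⊆ {z : α × α | κ z.1 = κ z.2} :=
      iUnion₂_subset fun j _ z hz => hz.1.trans hz.2.symm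
    refine le_trans (le_of_eq ?_) (measureReal_mono hsub)
    rw [measureReal_biUnion_finset (fun i _ j _ hij => Disjoint.set_prod_left (hdisj hij) _ _)
      fun j _ => (hmeas j).prod (hmeas j)]
    simp only [measureReal_prod_prod, sq]
  calc (1 : ℝ) = (∑ j ∈ J, μ.real (κ ⁻¹' {j})) ^ 2 := by rw [hsum, one_pow]
    _ ≤ J.card * ∑ j ∈ J, μ.real (κ ⁻¹' {j}) ^ 2 := sq_sum_le_card_mul_sum_sq
    _ ≤ _ := by gcongr

variable {μ : Measure ℝ} [IsProbabilityMeasure μ] {V W : ℝ}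

lemma le_of_ae_mem_Icc (hs : ∀ᵐ v ∂μ, v ∈ Icc V W) : V ≤ W :=
  let ⟨_, hv⟩ := hs.exists
  hv.1.trans hv.2

lemma le_mul_measureReal_abs_sub_lt (hs : ∀ᵐ v ∂μ, v ∈ Icc V W) {x : ℝ} (hx : 0 < x) :
    x ≤ (W - V + x) * (μ.prod μ).real {z | |z.1 - z.2| < x} := by
  have hVW := sub_nonneg.2 (le_of_ae_mem_Icc hs)
  -- cut `[V, W]` into cells of length `x`: two values in the same cell are less than `x` apart
  let cell : ℝ → ℤ := fun s => ⌊(s - V) / x⌋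
  have hcell : Measurable cell := Int.measurable_floor.comp (by fun_prop)
  have hmem : ∀ᵐ v ∂μ, cell v ∈ Finset.Icc 0 ⌊(W - V) / x⌋ := by
    filter_upwards [hs] with v hv
    refine Finset.mem_Icc.2 ⟨Int.floor_nonneg.2 (div_nonneg (sub_nonneg.2 hv.1) hx.le), ?_⟩
    exact Int.floor_mono (by have := hv.2; gcongr)
  have hcard : ((Finset.Icc 0 ⌊(W - V) / x⌋).card : ℝ) ≤ (W - V) / x + 1 := by
    have hfloor : 0 ≤ ⌊(W - V) / x⌋ := Int.floor_nonneg.2 (by positivity)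
    rw [Int.card_Icc, sub_zero, ← Int.cast_natCast, Int.toNat_of_nonneg (by lia), Int.cast_add,
      Int.cast_one]
    gcongr
    exact Int.floor_le _
  have hsub : {z : ℝ × ℝ | cell z.1 = cell z.2} ⊆ {z | |z.1 - z.2| < x} := fun z hz => by
    have habs := Int.abs_sub_lt_one_of_floor_eq_floor hz
    rwa [← sub_div, sub_sub_sub_cancel_right, abs_div, abs_of_pos hx, div_lt_one hx] at habs
  calc x ≤ x * (((W - V) / x + 1) * (μ.prod μ).real {z | |z.1 - z.2| < x}) := by
        refine le_mul_of_one_le_right hx.le ?_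
        refine (one_le_card_mul_measureReal_eq hcell _ hmem).trans ?_
        exact mul_le_mul hcard (measureReal_mono hsub) measureReal_nonneg (by positivity)
    _ = _ := by field_simp

lemma two_mul_secondDemand_add_le (θ : ℝ) {x : ℝ} (hx : 0 < x) :
    2 * secondDemand μ θ x + (μ.prod μ).real {z | |z.1 - z.2| < x} ≤ 1 := by
  let A : Set (ℝ × ℝ) := {z | z.1 + x < z.2}
  have hA : MeasurableSet A :=
    measurableSet_lt (f := fun z : ℝ × ℝ => z.1 + x) (by fun_prop) measurable_snd
  have hswap : (μ.prod μ).real (Prod.swap ⁻¹' A) = (μ.prod μ).real A :=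
    Measure.measurePreserving_swap.measureReal_preimage hA.nullMeasurableSet
  have hdisj : Disjoint A (Prod.swap ⁻¹' A) :=
    disjoint_left.2 fun z (h : z.1 + x < z.2) (h' : z.2 + x < z.1) => by linarith
  have hclose : (μ.prod μ).real {z | |z.1 - z.2| < x} ≤
      1 - ((μ.prod μ).real A + (μ.prod μ).real A) := by
    nth_rewrite 2 [← hswap]
    rw [← measureReal_union hdisj (measurable_swap hA),
      ← probReal_compl_eq_one_sub (hA.union (measurable_swap hA))]
    refine measureReal_mono fun z hz => ?_
    obtain ⟨hl, hr⟩ := abs_lt.1 (mem_ofPred_eq ▸ hz)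
    rintro (h | h)
    · exact absurd (show z.1 + x < z.2 from h) (by linarith)
    · exact absurd (show z.2 + x < z.1 from h) (by linarith)
  have hD : secondDemand μ θ x ≤ (μ.prod μ).real A := measureReal_mono fun z hz => hz.2
  linarith

lemma secondDemand_lt_half (hs : ∀ᵐ v ∂μ, v ∈ Icc V W) (θ : ℝ) {x : ℝ} (hx : 0 < x) :
    secondDemand μ θ x < 1 / 2 := by
  have hVW := sub_nonneg.2 (le_of_ae_mem_Icc hs)
  have hclose : 0 < (μ.prod μ).real {z | |z.1 - z.2| < x} :=
    pos_of_mul_pos_right (hx.trans_le (le_mul_measureReal_abs_sub_lt hs hx)) (by linarith)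
  linarith [two_mul_secondDemand_add_le (μ := μ) θ hx]

lemma mul_secondDemand_le_width (hs : ∀ᵐ v ∂μ, v ∈ Icc V W) (θ : ℝ) {x : ℝ} (hx : 0 < x) :
    x * secondDemand μ θ x ≤ (W - V) * (1 / 2 - secondDemand μ θ x) := by
  have hVW := sub_nonneg.2 (le_of_ae_mem_Icc hs)
  have hclose := le_mul_measureReal_abs_sub_lt hs hx
  have hD := mul_le_mul_of_nonneg_left (two_mul_secondDemand_add_le (μ := μ) θ hx)
    (show 0 ≤ W - V + x by linarith)
  linarith

lemma exists_lt_lt_secondDemand {d θ x : ℝ} (h : d < secondDemand μ θ x) :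
    ∃ θ' < θ, d < secondDemand μ θ' x := by
  obtain ⟨u, hu, hlt, hlim⟩ := exists_seq_strictMono_tendsto θ
  have hmono : Monotone fun n => {z : ℝ × ℝ | z.1 + x < u n ∧ z.1 + x < z.2} :=
    fun m n hmn z hz => ⟨hz.1.trans_le (hu.monotone hmn), hz.2⟩
  have hunion : ⋃ n, {z : ℝ × ℝ | z.1 + x < u n ∧ z.1 + x < z.2} =
      {z | z.1 + x < θ ∧ z.1 + x < z.2} := by
    refine subset_antisymm (iUnion_subset fun n z hz => ⟨hz.1.trans (hlt n), hz.2⟩) fun z hz => ?_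
    obtain ⟨n, hn⟩ := (hlim.eventually (lt_mem_nhds hz.1)).exists
    exact mem_iUnion.2 ⟨n, hn, hz.2⟩
  have hconv : Tendsto (fun n => secondDemand μ (u n) x) atTop (𝓝 (secondDemand μ θ x)) := by
    have := tendsto_measure_iUnion_atTop (μ := μ.prod μ) hmono
    rw [hunion] at this
    exact (ENNReal.tendsto_toReal (measure_ne_top _ _)).comp this
  obtain ⟨n, hn⟩ := (hconv.eventually (lt_mem_nhds h)).exists
  exact ⟨u n, hlt n, hn⟩

variable [NullSingletonClass μ]

lemma tStar_le (hs : ∀ᵐ v ∂μ, v ∈ Icc V W) {c r : ℝ}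
    (h : ∀ x, 0 < x → x * secondDemand μ (theta0 μ c) x ≤
      r * (1 / 2 - secondDemand μ (theta0 μ c) x)) : tStar μ V c ≤ r := by
  refine csSup_le (nonempty_Ioi.image _) ?_
  rintro _ ⟨x, hx, rfl⟩
  simp only [deviationDemand_eq hs]
  exact (div_le_iff₀ (sub_pos.2 (secondDemand_lt_half hs _ hx))).2 (h x hx)

lemma tStar_le_width (hs : ∀ᵐ v ∂μ, v ∈ Icc V W) (c : ℝ) : tStar μ V c ≤ W - V :=
  tStar_le hs fun _ hx => mul_secondDemand_le_width hs _ hx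

lemma mul_secondDemand_le_tStar (hs : ∀ᵐ v ∂μ, v ∈ Icc V W) (c : ℝ) {x : ℝ} (hx : 0 < x) :
    x * secondDemand μ (theta0 μ c) x ≤
      tStar μ V c * (1 / 2 - secondDemand μ (theta0 μ c) x) := by
  rw [← div_le_iff₀ (sub_pos.2 (secondDemand_lt_half hs _ hx)), ← deviationDemand_eq hs]
  refine le_csSup ⟨W - V, ?_⟩ ⟨x, hx, rfl⟩
  rintro _ ⟨y, hy, rfl⟩
  simp only [deviationDemand_eq hs]
  exact (div_le_iff₀ (sub_pos.2 (secondDemand_lt_half hs _ hy))).2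
    (mul_secondDemand_le_width hs _ hy)

lemma tStar_nonneg (hs : ∀ᵐ v ∂μ, v ∈ Icc V W) (c : ℝ) : 0 ≤ tStar μ V c :=
  nonneg_of_mul_nonneg_left ((mul_nonneg zero_le_one (secondDemand_nonneg _ _)).trans
    (mul_secondDemand_le_tStar hs c one_pos)) (sub_pos.2 (secondDemand_lt_half hs _ one_pos))

lemma antitoneOn_tStar (hs : ∀ᵐ v ∂μ, v ∈ Icc V W) : AntitoneOn (tStar μ V) (Ici 0) :=
  fun c hc d hd h => tStar_le hs fun x hx => by
    have hD := secondDemand_mono (μ := μ) ((strictAntiOn_theta0 hs).antitoneOn hc hd h) x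
    calc x * secondDemand μ (theta0 μ d) x ≤ x * secondDemand μ (theta0 μ c) x := by gcongr
      _ ≤ tStar μ V c * (1 / 2 - secondDemand μ (theta0 μ c) x) :=
        mul_secondDemand_le_tStar hs c hx
      _ ≤ tStar μ V c * (1 / 2 - secondDemand μ (theta0 μ d) x) :=
        mul_le_mul_of_nonneg_left (sub_le_sub_left hD _) (tStar_nonneg hs c)

lemma tStar_cBar (hs : ∀ᵐ v ∂μ, v ∈ Icc V W) : tStar μ V (cBar μ V) = 0 := by
  refine le_antisymm (tStar_le hs fun x hx => ?_) (tStar_nonneg hs _)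
  rw [secondDemand_eq_zero hs (by simpa [theta0_cBar hs] using hx.le)]
  simp

lemma tStar_le_theta0_sub (hs : ∀ᵐ v ∂μ, v ∈ Icc V W) {c : ℝ} (hV : V ≤ theta0 μ c)
    (h : cdf μ (theta0 μ c) ≤ 1 / 4) : tStar μ V c ≤ theta0 μ c - V := by
  refine tStar_le hs fun x hx => ?_
  rcases le_or_gt (theta0 μ c - V) x with hle | hlt
  · rw [secondDemand_eq_zero hs hle]
    linarith
  · have hD : secondDemand μ (theta0 μ c) x ≤ 1 / 4 :=
      (secondDemand_le_cdf _ _).trans (((cdf μ).mono (by linarith)).trans h)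
    exact mul_le_mul hlt.le (by linarith) (secondDemand_nonneg _ _) (by linarith)

lemma lowerSemicontinuousOn_tStar (hs : ∀ᵐ v ∂μ, v ∈ Icc V W) :
    LowerSemicontinuousOn (tStar μ V) (Ici 0) := by
  intro c hc y hy
  rcases lt_or_ge y 0 with hy0 | hy0
  · exact Eventually.of_forall fun d => hy0.trans_le (tStar_nonneg hs d)
  obtain ⟨_, ⟨x, hx, rfl⟩, hlt⟩ := exists_lt_of_lt_csSup (nonempty_Ioi.image _) hy
  have hx : 0 < x := hx
  have hxy : 0 < x + y := by linarith
  simp only [deviationDemand_eq hs] at hlt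
  rw [lt_div_iff₀ (sub_pos.2 (secondDemand_lt_half hs _ hx))] at hlt
  -- `y < x D / (1/2 - D)` amounts to `y / 2 / (x + y) < D`
  have hD : y / 2 / (x + y) < secondDemand μ (theta0 μ c) x := by
    rw [div_lt_iff₀ hxy]
    linarith
  obtain ⟨θ, hθ, hDθ⟩ := exists_lt_lt_secondDemand hD
  filter_upwards [self_mem_nhdsWithin,
    nhdsWithin_le_nhds (gt_mem_nhds ((lt_theta0_iff hs hc).1 hθ))] with d hd hdθ
  have hDd := hDθ.trans_le (secondDemand_mono ((lt_theta0_iff hs hd).2 hdθ).le x)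
  rw [div_lt_iff₀ hxy] at hDd
  refine lt_of_mul_lt_mul_right (lt_of_lt_of_le ?_ (mul_secondDemand_le_tStar hs d hx))
    (sub_pos.2 (secondDemand_lt_half hs _ hx)).le
  linarith

lemma surplusAtTStar_eq (hs : ∀ᵐ v ∂μ, v ∈ Icc V W) (hW : W ≤ 2 * V) {c : ℝ}
    (hc : c ∈ Icc 0 (cBar μ V)) : surplusAtTStar μ V c = searchWelfare μ c - tStar μ V c :=
  average_eq (by norm_num) fun w =>
    buyerUtility_eq hs hc ((tStar_le_width hs c).trans (by linarith)) w

lemma welfareAtTStar_eq (hs : ∀ᵐ v ∂μ, v ∈ Icc V W) (hW : W ≤ 2 * V) {c : ℝ}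
    (hc : c ∈ Icc 0 (cBar μ V)) : welfareAtTStar μ V c = searchWelfare μ c :=
  average_eq (by norm_num) fun w =>
    expectedWelfare_eq hs hc ((tStar_le_width hs c).trans (by linarith)) w

end LowestPrice

section Equilibrium

lemma IsStandard.alloc_eq_half {μ : Measure ℝ} {c t : ℝ} {M : ProminenceMechanism}
    (hM : IsStandard μ c M) (he : IsEquilibrium μ c M fun _ => t) :
    M.alloc (fun _ => t) = fun _ => 1 / 2 := by
  have hsum := hM.2 t he
  have hanon := hM.1 (Equiv.swap 0 1) (fun _ => t) 0
  rw [Equiv.swap_apply_left] at hanon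
  rw [Fin.sum_univ_two] at hsum
  ext i
  fin_cases i <;> simp only [Fin.zero_eta, Fin.mk_one] <;> linarith

/-- The mechanism that supports the price `t`: a seller who deviates from it loses prominence
to the other one. -/
noncomputable def punishDeviations (t : ℝ) : ProminenceMechanism where
  alloc p i := if p i = p i.rev then 1 / 2 else if p i.rev = t then 0
    else if p i = t then 1 else 1 / 2
  alloc_nonneg p i := by split_ifs <;> norm_num
  sum_alloc_le_one p := by
    rw [sum_eq_add_rev _ 0, Fin.rev_rev]
    by_cases h : p 0 = p (Fin.rev 0)
    · simp only [h, if_true, add_halves, le_refl]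
    · simp only [h, Ne.symm h, if_false]
      split_ifs <;> norm_num

lemma punishDeviations_const (t s : ℝ) :
    (punishDeviations t).alloc (fun _ => s) = fun _ => 1 / 2 := by
  simp [punishDeviations]

lemma punishDeviations_deviant {t : ℝ} {p : Fin 2 → ℝ} {i : Fin 2} (hi : p i ≠ t)
    (hrev : p i.rev = t) :
    (punishDeviations t).alloc p i = 0 ∧ (punishDeviations t).alloc p i.rev = 1 := by
  simp [punishDeviations, hi, hi.symm, hrev]

lemma isStandard_punishDeviations (μ : Measure ℝ) (c t : ℝ) :
    IsStandard μ c (punishDeviations t) := by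
  refine ⟨fun σ p i => ?_, fun s _ => ?_⟩
  · have hσ : ∀ (σ : Equiv.Perm (Fin 2)) (i : Fin 2), σ (σ i) = i ∧ (σ i).rev = σ i.rev := by
      decide
    simp only [punishDeviations, (hσ σ i).1, (hσ σ i).2, (hσ σ i.rev).1]
  · rw [punishDeviations_const, Fin.sum_univ_two, add_halves]

lemma purchaseProb_nonneg (μ : Measure ℝ) (p k : Fin 2 → ℝ) (i : Fin 2) :
    0 ≤ purchaseProb μ p k i :=
  le_sum_firstProb_mul fun _ _ => measureReal_nonneg

lemma revenue_punishDeviations_deviant {t : ℝ} {p : Fin 2 → ℝ} {i : Fin 2} (hi : p i ≠ t)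
    (hrev : p i.rev = t) (μ : Measure ℝ) (c : ℝ) :
    revenue μ c (punishDeviations t) p i = p i * purchaseProb μ p (prominentCosts c i.rev) i := by
  obtain ⟨h0, h1⟩ := punishDeviations_deviant hi hrev
  rw [revenue, average_eq_sum (by rw [sum_eq_add_rev _ i, h0, h1, zero_add]), sum_eq_add_rev _ i,
    h0, h1, zero_mul, zero_add, one_mul]

variable {μ : Measure ℝ} [IsProbabilityMeasure μ] {V W : ℝ}

lemma revenue_of_alloc_eq_half (hs : ∀ᵐ v ∂μ, v ∈ Icc V W) {c t : ℝ} (hc : c ∈ Ioc 0 (cBar μ V))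
    (ht : t ≤ V) {M : ProminenceMechanism} (hM : M.alloc (fun _ => t) = fun _ => 1 / 2)
    (i : Fin 2) : revenue μ c M (fun _ => t) i = t * (1 / 2) := by
  rw [revenue, hM, average_half_purchaseProb hs hc ht]

lemma isEquilibrium_punishDeviations (hs : ∀ᵐ v ∂μ, v ∈ Icc V W) {c t : ℝ}
    (hc : c ∈ Ioc 0 (cBar μ V)) (ht0 : 0 ≤ t) (ht : t ≤ V) (hθ : theta0 μ c + t < theta0 μ 0)
    (hF : cdf μ (theta0 μ c + t) ≤ 1 / 2)
    (hD : ∀ x, 0 < x → x * secondDemand μ (theta0 μ c) x ≤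
      t * (1 / 2 - secondDemand μ (theta0 μ c) x)) :
    IsEquilibrium μ c (punishDeviations t) fun _ => t := by
  intro i q
  rcases eq_or_ne q t with rfl | hqt
  · rw [Function.update_eq_self i (fun _ : Fin 2 => q)]
  have hi : Function.update (fun _ => t) i q i = q := Function.update_self ..
  have hrev : Function.update (fun _ => t) i q i.rev = t := Function.update_of_ne (rev_ne i) ..
  rw [revenue_of_alloc_eq_half hs hc ht (punishDeviations_const t t),
    revenue_punishDeviations_deviant (hi.trans_ne hqt) hrev, hi]
  rcases lt_or_ge q 0 with hq | hq
  · have := mul_nonpos_of_nonpos_of_nonneg hq.le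
      (purchaseProb_nonneg μ (Function.update (fun _ => t) i q) (prominentCosts c i.rev) i)
    linarith
  refine (mul_le_mul_of_nonneg_left (purchaseProb_le_secondDemand hs hc (x := q - t)
    (hrev.trans_le ht) (by rw [hi, hrev]; ring) (by linarith)) hq).trans ?_
  rcases hqt.lt_or_gt with h | h
  · have hhalf : secondDemand μ (theta0 μ c) (q - t) ≤ 1 / 2 :=
      (secondDemand_le_cdf _ _).trans (((cdf μ).mono (by linarith)).trans hF)
    exact mul_le_mul h.le hhalf (secondDemand_nonneg _ _) ht0
  · linarith [hD (q - t) (sub_pos.2 h)]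

lemma IsEquilibrium.price_nonneg (hs : ∀ᵐ v ∂μ, v ∈ Icc V W) {c t : ℝ}
    (hc : c ∈ Ioc 0 (cBar μ V)) (ht : t ≤ V) {M : ProminenceMechanism} (hM : IsStandard μ c M)
    (he : IsEquilibrium μ c M fun _ => t) : 0 ≤ t := by
  have hdev := he 0 0
  rw [revenue_of_alloc_eq_half hs hc ht (hM.alloc_eq_half he), revenue, Function.update_self,
    zero_mul] at hdev
  linarith

variable [NullSingletonClass μ]

lemma IsEquilibrium.tStar_le (hs : ∀ᵐ v ∂μ, v ∈ Icc V W) (hW : W ≤ 2 * V) {c t : ℝ}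
    (hc : c ∈ Ioc 0 (cBar μ V)) {M : ProminenceMechanism} (hM : IsStandard μ c M)
    (he : IsEquilibrium μ c M fun _ => t) : tStar μ V c ≤ t := by
  rcases lt_or_ge V t with ht | ht
  · linarith [tStar_le_width (μ := μ) hs c]
  refine ProminenceMarket.tStar_le hs fun x hx => ?_
  have hrev : Function.update (fun _ => t) 0 (t + x) (Fin.rev 0) = t :=
    Function.update_of_ne (rev_ne 0) ..
  have hdemand : secondDemand μ (theta0 μ c) x ≤
      average c (M.alloc (Function.update (fun _ => t) 0 (t + x))) fun k =>
        purchaseProb μ (Function.update (fun _ => t) 0 (t + x)) k 0 := by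
    have hle {k : Fin 2 → ℝ} : k 0 ∈ Icc 0 c → secondDemand μ (theta0 μ c) x ≤
        purchaseProb μ (Function.update (fun _ => t) 0 (t + x)) k 0 :=
      secondDemand_le_purchaseProb hs (hrev.trans_le ht) (by rw [hrev, Function.update_self])
    exact le_average (M.alloc_nonneg _) (M.sum_alloc_le_one _)
      (fun w => hle (prominentCosts_mem_Icc hc.1.le w 0)) (hle ⟨hc.1.le, le_rfl⟩)
  have hdev := he 0 (t + x)
  rw [revenue_of_alloc_eq_half hs hc ht (hM.alloc_eq_half he), revenue,
    Function.update_self] at hdev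
  have hmul := mul_le_mul_of_nonneg_left hdemand
    (add_nonneg (he.price_nonneg hs hc ht hM) hx.le)
  linarith

lemma surplusAtTStar_mem_upperBounds (hs : ∀ᵐ v ∂μ, v ∈ Icc V W) (hW : W ≤ 2 * V) {c : ℝ}
    (hc : c ∈ Ioc 0 (cBar μ V)) : surplusAtTStar μ V c ∈ upperBounds (achievableSurplus μ c) := by
  rintro s ⟨M, t, hM, he, rfl⟩
  have hc' := Ioc_subset_Icc_self hc
  rw [surplusAtTStar_eq hs hW hc', hM.alloc_eq_half he]
  refine average_le (by norm_num) (by norm_num) fun w => ?_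
  rcases le_total t V with ht | ht
  · rw [buyerUtility_eq hs hc' ht]
    exact sub_le_sub_left (he.tStar_le hs hW hc hM) _
  · refine (buyerUtility_le hs hc.1.le ht w).trans (sub_le_sub_left ?_ _)
    linarith [tStar_le_width (μ := μ) hs c]

lemma isLeast_and_isGreatest (hs : ∀ᵐ v ∂μ, v ∈ Icc V W) (hW : W ≤ 2 * V) {c : ℝ}
    (hc : c ∈ Ioc 0 (cBar μ V)) (hθ : theta0 μ c + tStar μ V c < theta0 μ 0)
    (hF : cdf μ (theta0 μ c + tStar μ V c) ≤ 1 / 2) :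
    IsLeast (implementablePrices μ c) (tStar μ V c) ∧
      IsGreatest (achievableSurplus μ c) (surplusAtTStar μ V c) := by
  have hst := isStandard_punishDeviations μ c (tStar μ V c)
  have heq := isEquilibrium_punishDeviations hs hc (tStar_nonneg hs c)
    ((tStar_le_width hs c).trans (by linarith)) hθ hF
    fun x hx => mul_secondDemand_le_tStar hs c hx
  refine ⟨⟨⟨_, hst, heq⟩, ?_⟩, ⟨_, _, hst, heq, ?_⟩, surplusAtTStar_mem_upperBounds hs hW hc⟩
  · rintro t ⟨M, hM, he⟩
    exact he.tStar_le hs hW hc hM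
  · rw [hst.alloc_eq_half heq, surplusAtTStar]

end Equilibrium

section Limits

variable {μ : Measure ℝ} [IsProbabilityMeasure μ] [NullSingletonClass μ] {V W : ℝ}

lemma cdf_eq_zero (hs : ∀ᵐ v ∂μ, v ∈ Icc V W) : cdf μ V = 0 := by
  have hne : ∀ᵐ v ∂μ, v ≠ V := by simp [ae_iff]
  rw [cdf_eq_real, measureReal_def, measure_eq_zero_iff_ae_notMem.2, ENNReal.toReal_zero]
  filter_upwards [hs, hne] with v hv hne hvV using hne (le_antisymm hvV hv.1)

lemma eventually_cdf_lt (hs : ∀ᵐ v ∂μ, v ∈ Icc V W) {r : ℝ} (hr : 0 < r) :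
    ∀ᶠ y in 𝓝[>] V, cdf μ y < r := by
  have h := ((cdf μ).right_continuous V).tendsto
  rw [cdf_eq_zero hs] at h
  exact (h.mono_left (nhdsWithin_mono _ Ioi_subset_Ici_self)).eventually (gt_mem_nhds hr)

lemma tendsto_tStar_cBar (hs : ∀ᵐ v ∂μ, v ∈ Icc V W) :
    Tendsto (tStar μ V) (𝓝[<] (cBar μ V)) (𝓝 0) := by
  have hθ := tendsto_theta0_cBar (μ := μ) hs
  have hlim : Tendsto (fun c => theta0 μ c - V) (𝓝[<] (cBar μ V)) (𝓝 0) := by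
    have := (hθ.mono_right nhdsWithin_le_nhds).sub_const V
    rwa [sub_self] at this
  refine tendsto_of_tendsto_of_tendsto_of_le_of_le' tendsto_const_nhds hlim
    (Eventually.of_forall (tStar_nonneg hs)) ?_
  filter_upwards [hθ.eventually self_mem_nhdsWithin,
    hθ.eventually (eventually_cdf_lt hs (r := 1 / 4) (by norm_num))] with c hV hF
  exact tStar_le_theta0_sub hs (le_of_lt hV) hF.le

lemma tendsto_tStar_zero (hs : ∀ᵐ v ∂μ, v ∈ Icc V W) :
    Tendsto (tStar μ V) (𝓝[>] 0) (𝓝 (tStar μ V 0)) := by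
  refine tendsto_order.2 ⟨fun y hy => ?_, fun y hy => ?_⟩
  · exact (lowerSemicontinuousOn_tStar hs 0 self_mem_Ici y hy).filter_mono
      (nhdsWithin_mono _ Ioi_subset_Ici_self)
  · filter_upwards [self_mem_nhdsWithin] with c hc
    exact (antitoneOn_tStar hs self_mem_Ici (Ioi_subset_Ici_self hc) (le_of_lt hc)).trans_lt hy

lemma eventually_isLeast_and_isGreatest (hs : ∀ᵐ v ∂μ, v ∈ Icc V W) (hW : W ≤ 2 * V) :
    ∀ᶠ c in 𝓝[<] (cBar μ V), IsLeast (implementablePrices μ c) (tStar μ V c) ∧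
      IsGreatest (achievableSurplus μ c) (surplusAtTStar μ V c) := by
  have hθ := tendsto_theta0_cBar (μ := μ) hs
  have hsum : Tendsto (fun c => theta0 μ c + tStar μ V c) (𝓝[<] (cBar μ V)) (𝓝[>] V) := by
    refine tendsto_nhdsWithin_iff.2
      ⟨by simpa using (hθ.mono_right nhdsWithin_le_nhds).add (tendsto_tStar_cBar hs), ?_⟩
    filter_upwards [hθ.eventually self_mem_nhdsWithin] with c hc
    exact lt_add_of_lt_of_nonneg hc (tStar_nonneg hs c)
  filter_upwards [hsum.eventually (eventually_cdf_lt hs (r := 1 / 2) (by norm_num)),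
    hsum.eventually (nhdsWithin_le_nhds (gt_mem_nhds (lt_theta0 hs le_rfl (cBar_pos hs)))),
    self_mem_nhdsWithin, nhdsWithin_le_nhds (lt_mem_nhds (cBar_pos hs))] with c hF hlt hc hc0
  exact isLeast_and_isGreatest hs hW ⟨hc0, le_of_lt hc⟩ hlt hF.le

lemma tendsto_surplusAtTStar_zero (hs : ∀ᵐ v ∂μ, v ∈ Icc V W) (hW : W ≤ 2 * V) :
    Tendsto (surplusAtTStar μ V) (𝓝[>] 0) (𝓝 (surplusAtTStar μ V 0)) := by
  have hpos := cBar_pos (μ := μ) hs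
  rw [surplusAtTStar_eq hs hW ⟨le_rfl, hpos.le⟩]
  refine Tendsto.congr' ?_ (((continuous_searchWelfare hs).continuousWithinAt.tendsto).sub
    (tendsto_tStar_zero hs))
  filter_upwards [self_mem_nhdsWithin, nhdsWithin_le_nhds (gt_mem_nhds hpos)] with c hc hcBar
  exact (surplusAtTStar_eq hs hW ⟨le_of_lt hc, le_of_lt hcBar⟩).symm

lemma eventually_surplusAtTStar_eq (hs : ∀ᵐ v ∂μ, v ∈ Icc V W) (hW : W ≤ 2 * V) :
    ∀ᶠ c in 𝓝[<] (cBar μ V), surplusAtTStar μ V c = searchWelfare μ c - tStar μ V c := by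
  filter_upwards [self_mem_nhdsWithin, nhdsWithin_le_nhds (lt_mem_nhds (cBar_pos hs))]
    with c hc hc0 using surplusAtTStar_eq hs hW ⟨le_of_lt hc0, le_of_lt hc⟩

lemma tendsto_surplusAtTStar_cBar (hs : ∀ᵐ v ∂μ, v ∈ Icc V W) (hW : W ≤ 2 * V) :
    Tendsto (surplusAtTStar μ V) (𝓝[<] (cBar μ V)) (𝓝 (∫ v, v ∂μ)) := by
  have h := ((continuous_searchWelfare hs).continuousWithinAt.tendsto (x := cBar μ V)).sub
    (tendsto_tStar_cBar hs)
  rw [searchWelfare_cBar hs, sub_zero] at h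
  exact h.congr' ((eventually_surplusAtTStar_eq hs hW).mono fun _ hc => hc.symm)

lemma exists_surplusAtTStar_max (hs : ∀ᵐ v ∂μ, v ∈ Icc V W) (hW : W ≤ 2 * V) :
    ∃ c' ∈ Icc 0 (cBar μ V), ∀ c ∈ Icc 0 (cBar μ V),
      surplusAtTStar μ V c ≤ surplusAtTStar μ V c' := by
  have hlsc : LowerSemicontinuousOn (fun c => tStar μ V c + -searchWelfare μ c)
      (Icc 0 (cBar μ V)) :=
    ((lowerSemicontinuousOn_tStar hs).mono fun _ hc => hc.1).add
      ((continuous_searchWelfare hs).fun_neg.lowerSemicontinuous.lowerSemicontinuousOn _)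
  obtain ⟨c', hc', hmin⟩ :=
    hlsc.exists_isMinOn (nonempty_Icc.2 (cBar_pos hs).le) isCompact_Icc
  refine ⟨c', hc', fun c hc => ?_⟩
  rw [surplusAtTStar_eq hs hW hc, surplusAtTStar_eq hs hW hc']
  linarith [isMinOn_iff.1 hmin c hc]

lemma exists_surplusAtTStar_max_lt (hs : ∀ᵐ v ∂μ, v ∈ Icc V W) (hW : W ≤ 2 * V)
    (h : ∀ᶠ c in 𝓝[<] (cBar μ V), ∫ v, v ∂μ < surplusAtTStar μ V c) :
    ∃ c' ∈ Ico 0 (cBar μ V),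
      (∀ c ∈ Icc 0 (cBar μ V), surplusAtTStar μ V c ≤ surplusAtTStar μ V c') ∧
      ∫ v, v ∂μ < surplusAtTStar μ V c' := by
  have hpos := cBar_pos (μ := μ) hs
  obtain ⟨c', hc', hmax⟩ := exists_surplusAtTStar_max (μ := μ) hs hW
  obtain ⟨d, hd, hdBar, hd0⟩ := (h.and (eventually_mem_nhdsWithin.and
    (nhdsWithin_le_nhds (lt_mem_nhds hpos)))).exists
  have hlt := hd.trans_le (hmax d ⟨le_of_lt hd0, le_of_lt hdBar⟩)
  refine ⟨c', ⟨hc'.1, lt_of_le_of_ne hc'.2 ?_⟩, hmax, hlt⟩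
  rintro rfl
  rw [surplusAtTStar_eq hs hW ⟨hpos.le, le_rfl⟩, searchWelfare_cBar hs, tStar_cBar hs,
    sub_zero] at hlt
  exact lt_irrefl _ hlt

end Limits

section Fubini

lemma intervalIntegrable_cdf (μ : Measure ℝ) (x y : ℝ) : IntervalIntegrable (cdf μ) volume x y :=
  (cdf μ).mono.intervalIntegrable

variable {μ : Measure ℝ} [IsProbabilityMeasure μ] {V W : ℝ}

lemma integral_intervalIntegral_min (hs : ∀ᵐ v ∂μ, v ∈ Icc V W) {θ : ℝ} (hθ : V ≤ θ) {h : ℝ → ℝ}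
    (hh : IntervalIntegrable h volume V θ) :
    ∫ v, (∫ u in min v θ..θ, h u) ∂μ = ∫ u in V..θ, cdf μ u * h u := by
  have hrestrict : ∀ᵐ v ∂μ,
      ∫ u in min v θ..θ, h u = ∫ u in Ioc V θ, (Ici v).indicator h u := by
    filter_upwards [hs] with v hv
    rw [intervalIntegral.integral_of_le (min_le_right v θ), setIntegral_indicator measurableSet_Ici]
    have hset : Ioc (min v θ) θ = Ioc V θ ∩ Ioi v := by
      ext u
      simp only [mem_inter_iff, mem_Ioc, mem_Ioi, inf_lt_iff]
      grind
    rw [hset]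
    exact setIntegral_congr_set ((ae_eq_refl _).inter Ioi_ae_eq_Ici)
  have hint : Integrable (Function.uncurry fun v u => (Ici v).indicator h u)
      (μ.prod (volume.restrict (Ioc V θ))) :=
    (hh.1.comp_snd μ).indicator (measurableSet_le measurable_fst measurable_snd)
  rw [integral_congr_ae hrestrict, integral_integral_swap hint,
    intervalIntegral.integral_of_le hθ]
  refine integral_congr_ae (ae_of_all _ fun u => ?_)
  calc ∫ v, (Ici v).indicator h u ∂μ = ∫ v, (Iic u).indicator (fun _ => h u) v ∂μ := rfl
    _ = cdf μ u * h u := by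
      rw [integral_indicator measurableSet_Iic, setIntegral_const, smul_eq_mul, cdf_eq_real]

lemma integral_max_sub_eq_integral_cdf (hs : ∀ᵐ v ∂μ, v ∈ Icc V W) {θ : ℝ} (hθ : V ≤ θ) :
    ∫ v, max (θ - v) 0 ∂μ = ∫ u in V..θ, cdf μ u := by
  have h := integral_intervalIntegral_min hs hθ (h := fun _ => 1) intervalIntegrable_const
  simp only [integral_one, mul_one] at h
  rw [← h]
  refine integral_congr_ae (ae_of_all _ fun v => ?_)
  rcases le_total v θ with hv | hv <;> simp [hv]

lemma searchGain_eq_sub_add_integral_cdf (hs : ∀ᵐ v ∂μ, v ∈ Icc V W) {θ : ℝ} (hθ : V ≤ θ) :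
    searchGain μ θ = ∫ v, v ∂μ - θ + ∫ u in V..θ, cdf μ u := by
  have hid : Integrable (fun v : ℝ => v - θ) μ := integrable_of_ae_mem_Icc hs (by fun_prop)
  have hmax : Integrable (fun v : ℝ => max (θ - v) 0) μ :=
    integrable_of_ae_mem_Icc hs (by fun_prop)
  calc searchGain μ θ = ∫ v, (v - θ + max (θ - v) 0) ∂μ := by
        refine integral_congr_ae (ae_of_all _ fun v => ?_)
        rcases le_total v θ with hv | hv <;> simp [hv]
    _ = ∫ v, v ∂μ - θ + ∫ u in V..θ, cdf μ u := by
        rw [integral_add hid hmax, integral_max_sub_eq_integral_cdf hs hθ,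
          integral_sub (integrable_of_ae_mem_Icc hs (by fun_prop)) (integrable_const θ)]
        simp

lemma searchGain_sub_searchGain (hs : ∀ᵐ v ∂μ, v ∈ Icc V W) {s θ : ℝ} (hs₀ : V ≤ s) (hsθ : s ≤ θ) :
    searchGain μ s - searchGain μ θ = ∫ u in s..θ, (1 - cdf μ u) := by
  rw [searchGain_eq_sub_add_integral_cdf hs hs₀,
    searchGain_eq_sub_add_integral_cdf hs (hs₀.trans hsθ), intervalIntegral.integral_sub
    intervalIntegrable_const (intervalIntegrable_cdf μ s θ), integral_one,
    ← intervalIntegral.integral_add_adjacent_intervals (intervalIntegrable_cdf μ V s)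
      (intervalIntegrable_cdf μ s θ)]
  ring

lemma integral_max_searchGain_sub_eq (hs : ∀ᵐ v ∂μ, v ∈ Icc V W) {θ : ℝ} (hθ : V ≤ θ) :
    ∫ v, max (searchGain μ v - searchGain μ θ) 0 ∂μ =
      ∫ u in V..θ, cdf μ u * (1 - cdf μ u) := by
  rw [← integral_intervalIntegral_min hs hθ
    (intervalIntegrable_const.sub (intervalIntegrable_cdf μ V θ))]
  refine integral_congr_ae ?_
  filter_upwards [hs] with v hv
  rw [← searchGain_sub_searchGain hs (le_min hv.1 hθ) (min_le_right v θ)]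
  rcases le_total v θ with hvθ | hvθ
  · rw [min_eq_left hvθ, max_eq_left (sub_nonneg.2 (searchGain_antitone hs hvθ))]
  · rw [min_eq_right hvθ, sub_self, max_eq_right (sub_nonpos.2 (searchGain_antitone hs hvθ))]

lemma secondDemand_le_integral_cdf (hs : ∀ᵐ v ∂μ, v ∈ Icc V W) {a x y : ℝ} (hx : 0 < x)
    (hy : 0 ≤ y) (ha : 0 ≤ a) (ha₁ : a * (x + y) ≤ 1)
    (hF : ∀ s ∈ Ioc 0 (x + y), a * s ≤ cdf μ (V + s)) :
    secondDemand μ (V + (x + y)) x ≤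
      (1 - a * (x + y)) * cdf μ (V + y) + a * ∫ u in V..V + y, cdf μ u := by
  have hmax : Integrable (fun v : ℝ => max (V + y - v) 0) μ :=
    integrable_of_ae_mem_Icc hs (by fun_prop)
  have hind : Integrable ((Iic (V + y)).indicator fun _ => 1 - a * (x + y)) μ :=
    (integrable_const _).indicator measurableSet_Iic
  have hsub : V + (x + y) - x = V + y := by ring
  rw [secondDemand_eq_integral, hsub]
  calc ∫ v, (Iio (V + y)).indicator (fun v => 1 - cdf μ (v + x)) v ∂μ
      ≤ ∫ v, ((Iic (V + y)).indicator (fun _ => 1 - a * (x + y)) v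
          + a * max (V + y - v) 0) ∂μ := by
        refine integral_mono_of_nonneg (ae_of_all _ fun v => ?_) (hind.add (hmax.const_mul a)) ?_
        · exact indicator_nonneg (fun v _ => sub_nonneg.2 (cdf_le_one μ _)) v
        · filter_upwards [hs] with v hv
          rcases lt_or_ge v (V + y) with hvy | hvy
          · have hbound := hF (v - V + x) ⟨by linarith [hv.1], by linarith⟩
            rw [show V + (v - V + x) = v + x by ring] at hbound
            rw [indicator_of_mem (mem_Iio.2 hvy), indicator_of_mem (mem_Iic.2 hvy.le),
              max_eq_left (by linarith)]
            linarith
          · rw [indicator_of_notMem (notMem_Iio.2 hvy)]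
            exact add_nonneg (indicator_nonneg (fun _ _ => sub_nonneg.2 ha₁) v)
              (mul_nonneg ha (le_max_right _ _))
    _ = (1 - a * (x + y)) * cdf μ (V + y) + a * ∫ u in V..V + y, cdf μ u := by
        rw [integral_add hind (hmax.const_mul a), integral_const_mul,
          integral_max_sub_eq_integral_cdf hs (by linarith), integral_indicator measurableSet_Iic,
          setIntegral_const, smul_eq_mul, cdf_eq_real, mul_comm (μ.real _)]

end Fubini

section Asymptotics

open Asymptotics

lemma integral_linear_add_quadratic (a b x : ℝ) :
    ∫ s in (0 : ℝ)..x, (a * s + b * s ^ 2) = a / 2 * x ^ 2 + b / 3 * x ^ 3 := by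
  rw [intervalIntegral.integral_add (Continuous.intervalIntegrable (by fun_prop) _ _)
    (Continuous.intervalIntegrable (by fun_prop) _ _), intervalIntegral.integral_const_mul,
    intervalIntegral.integral_const_mul, integral_id, integral_pow]
  norm_num
  ring

lemma isLittleO_integral_pow_succ {g : ℝ → ℝ} {n : ℕ} (hg : g =o[𝓝[>] 0] fun s => s ^ n) :
    (fun δ => ∫ s in (0 : ℝ)..δ, g s) =o[𝓝[>] 0] fun δ => δ ^ (n + 1) := by
  refine isLittleO_iff.2 fun ε hε => ?_
  obtain ⟨η, hη, hbound⟩ := mem_nhdsGT_iff_exists_Ioo_subset.1 (hg.def hε)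
  filter_upwards [Ioo_mem_nhdsGT hη] with δ hδ
  have hle : ∀ s ∈ uIoc 0 δ, ‖g s‖ ≤ ε * δ ^ n := fun s hs => by
    rw [uIoc_of_le hδ.1.le] at hs
    refine (hbound ⟨hs.1, hs.2.trans_lt hδ.2⟩).trans ?_
    rw [norm_pow, Real.norm_of_nonneg hs.1.le]
    have := hs.1.le
    gcongr
    exact hs.2
  calc ‖∫ s in (0 : ℝ)..δ, g s‖ ≤ ε * δ ^ n * |δ - 0| :=
        intervalIntegral.norm_integral_le_of_norm_le_const hle
    _ = ε * ‖δ ^ (n + 1)‖ := by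
        rw [sub_zero, norm_pow, Real.norm_eq_abs, abs_of_pos hδ.1, pow_succ, mul_assoc]

lemma eventually_lt_of_isLittleO {g : ℝ → ℝ} {n : ℕ} {ε : ℝ}
    (hg : g =o[𝓝[>] 0] fun s => s ^ n) (hε : 0 < ε) : ∀ᶠ s in 𝓝[>] 0, |g s| < ε * s ^ n := by
  filter_upwards [hg.def (half_pos hε), self_mem_nhdsWithin] with s hs hpos
  have hpos : 0 < s := hpos
  rw [Real.norm_eq_abs, Real.norm_of_nonneg (by positivity)] at hs
  nlinarith [mul_pos hε (pow_pos hpos n)]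

lemma eventually_forall_pos_add_mul {X : Type*} [TopologicalSpace X] {K : Set X} {p : X → ℝ}
    {q : ℝ → X → ℝ} (hK : IsCompact K) (hp : Continuous p) (hq : Continuous (Function.uncurry q))
    (hp₀ : ∀ u ∈ K, 0 ≤ p u) (hq₀ : ∀ u ∈ K, p u = 0 → 0 < q 0 u) :
    ∀ᶠ δ in 𝓝[>] 0, ∀ u ∈ K, 0 < p u + δ * q δ u := by
  suffices h : ∀ᶠ δ : ℝ in 𝓝 0, ∀ u ∈ K, 0 < δ → u ∈ K → 0 < p u + δ * q δ u by
    filter_upwards [nhdsWithin_le_nhds h, self_mem_nhdsWithin] with δ hδ hpos u hu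
    exact hδ u hu hpos hu
  refine hK.eventually_forall_of_forall_eventually fun u hu => ?_
  rcases (hp₀ u hu).eq_or_lt with hpu | hpu
  · have hqpos := (hq.tendsto (0, u)).eventually (lt_mem_nhds (hq₀ u hu hpu.symm))
    filter_upwards [hqpos] with z hz hδ hzK
    exact add_pos_of_nonneg_of_pos (hp₀ _ hzK) (mul_pos hδ hz)
  · have hcont : Continuous fun z : ℝ × X => p z.2 + z.1 * q z.1 z.2 :=
      (hp.comp continuous_snd).add (continuous_fst.mul hq)
    filter_upwards [(hcont.tendsto (0, u)).eventually (lt_mem_nhds (by simpa using hpu))]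
      with z hz _ _ using hz

end Asymptotics

section Expansion

open Asymptotics

variable {μ : Measure ℝ} {V a b : ℝ}

lemma cdf_mul_one_sub_cdf_isLittleO
    (hF : (fun s => cdf μ (V + s) - (a * s + b / 2 * s ^ 2)) =o[𝓝[>] 0] fun s => s ^ 2) :
    (fun s => cdf μ (V + s) * (1 - cdf μ (V + s)) - (a * s + (b / 2 - a ^ 2) * s ^ 2))
      =o[𝓝[>] 0] fun s => s ^ 2 := by
  have hbdd : (fun s => 1 - (a * s + b / 2 * s ^ 2) - cdf μ (V + s)) =O[𝓝[>] 0]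
      fun _ => (1 : ℝ) := by
    have hpoly : Continuous fun s : ℝ => 1 - (a * s + b / 2 * s ^ 2) := by fun_prop
    refine ((hpoly.tendsto 0).mono_left nhdsWithin_le_nhds).isBigO_one ℝ |>.sub
      (isBigO_of_le _ fun s => ?_)
    simpa [abs_of_nonneg (cdf_nonneg μ (V + s))] using cdf_le_one μ (V + s)
  have hhigher : (fun s : ℝ => -(a * b) * s ^ 3 - b ^ 2 / 4 * s ^ 4) =o[𝓝[>] 0]
      fun s => s ^ 2 :=
    (((isLittleO_pow_pow (by norm_num)).const_mul_left _).sub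
      ((isLittleO_pow_pow (by norm_num)).const_mul_left _)).mono nhdsWithin_le_nhds
  refine ((hF.mul_isBigO hbdd).add (hhigher.congr_right fun s => (mul_one _).symm)).congr
    (fun s => ?_) fun s => mul_one _
  ring

lemma eventually_lt_integral_cdf_mul
    (hF : (fun s => cdf μ (V + s) - (a * s + b / 2 * s ^ 2)) =o[𝓝[>] 0] fun s => s ^ 2)
    {γ : ℝ} (hγ : γ < b / 6 - a ^ 2 / 3) :
    ∀ᶠ δ in 𝓝[>] 0, a / 2 * δ ^ 2 + γ * δ ^ 3 <
      ∫ u in V..V + δ, cdf μ u * (1 - cdf μ u) := by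
  have hsmall := eventually_lt_of_isLittleO
    (isLittleO_integral_pow_succ (cdf_mul_one_sub_cdf_isLittleO hF)) (sub_pos.2 hγ)
  filter_upwards [hsmall] with δ hδ
  have hshift : ∫ u in V..V + δ, cdf μ u * (1 - cdf μ u) =
      ∫ s in (0 : ℝ)..δ, cdf μ (V + s) * (1 - cdf μ (V + s)) := by
    rw [intervalIntegral.integral_comp_add_left fun u => cdf μ u * (1 - cdf μ u), add_zero]
  have hint : IntervalIntegrable (fun s => cdf μ (V + s) * (1 - cdf μ (V + s))) volume 0 δ := by
    have hmono : Monotone fun s => cdf μ (V + s) := fun s t hst =>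
      (cdf μ).mono (add_le_add_right hst V)
    refine hmono.intervalIntegrable.mono_fun
      (hmono.measurable.mul (measurable_const.sub hmono.measurable)).aestronglyMeasurable
      (ae_of_all _ fun s => ?_)
    refine (norm_mul_le _ _).trans (mul_le_of_le_one_right (norm_nonneg _) ?_)
    rw [Real.norm_of_nonneg (sub_nonneg.2 (cdf_le_one μ _))]
    linarith [cdf_nonneg μ (V + s)]
  rw [intervalIntegral.integral_sub hint (Continuous.intervalIntegrable (by fun_prop) _ _),
    integral_linear_add_quadratic, abs_lt] at hδ
  rw [hshift]
  linarith [hδ.1]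

lemma eventually_cdf_bounds {β : ℝ}
    (hF : (fun s => cdf μ (V + s) - (a * s + b / 2 * s ^ 2)) =o[𝓝[>] 0] fun s => s ^ 2)
    (hb : 0 < b) (hβ : b < β) :
    ∀ᶠ s in 𝓝[>] 0, a * s ≤ cdf μ (V + s) ∧ cdf μ (V + s) ≤ a * s + β / 2 * s ^ 2 := by
  filter_upwards [eventually_lt_of_isLittleO hF (half_pos hb),
    eventually_lt_of_isLittleO hF (half_pos (sub_pos.2 hβ))] with s hlow hupp
  constructor
  · linarith [(abs_lt.1 hlow).1]
  · linarith [(abs_lt.1 hupp).2]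

lemma secondDemand_le_quadratic [IsProbabilityMeasure μ] {W β x y : ℝ}
    (hs : ∀ᵐ v ∂μ, v ∈ Icc V W) (hx : 0 < x) (hy : 0 < y) (ha : 0 ≤ a) (hβ : 0 ≤ β)
    (ha₁ : a * (x + y) ≤ 1)
    (hF : ∀ s ∈ Ioc 0 (x + y), a * s ≤ cdf μ (V + s) ∧ cdf μ (V + s) ≤ a * s + β / 2 * s ^ 2) :
    secondDemand μ (V + (x + y)) x ≤
      a * y + β / 2 * y ^ 2 - a ^ 2 * (y ^ 2 / 2 + x * y) := by
  have hdemand := secondDemand_le_integral_cdf hs hx hy.le ha ha₁ fun s hs => (hF s hs).1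
  have hcdf : cdf μ (V + y) ≤ a * y + β / 2 * y ^ 2 := (hF y ⟨hy, by linarith⟩).2
  have hint : ∫ u in V..V + y, cdf μ u ≤ a / 2 * y ^ 2 + β / 6 * y ^ 3 := by
    calc ∫ u in V..V + y, cdf μ u = ∫ s in (0 : ℝ)..y, cdf μ (V + s) := by
          rw [intervalIntegral.integral_comp_add_left fun u => cdf μ u, add_zero]
      _ ≤ ∫ s in (0 : ℝ)..y, (a * s + β / 2 * s ^ 2) := by
          refine intervalIntegral.integral_mono_on_of_le_Ioo hy.le
            (Monotone.intervalIntegrable fun s t hst => (cdf μ).mono (add_le_add_right hst V))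
            (Continuous.intervalIntegrable (by fun_prop) _ _) fun s hs => ?_
          exact (hF s ⟨hs.1, by linarith [hs.2]⟩).2
      _ = a / 2 * y ^ 2 + β / 6 * y ^ 3 := by
          rw [integral_linear_add_quadratic]
          ring
  calc secondDemand μ (V + (x + y)) x
      ≤ (1 - a * (x + y)) * (a * y + β / 2 * y ^ 2) + a * (a / 2 * y ^ 2 + β / 6 * y ^ 3) := by
        refine hdemand.trans (add_le_add ?_ (mul_le_mul_of_nonneg_left hint ha))
        exact mul_le_mul_of_nonneg_left hcdf (sub_nonneg.2 ha₁)
    _ = a * y + β / 2 * y ^ 2 - a ^ 2 * (y ^ 2 / 2 + x * y)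
          - a * β * y ^ 2 * (x / 2 + y / 3) := by ring
    _ ≤ a * y + β / 2 * y ^ 2 - a ^ 2 * (y ^ 2 / 2 + x * y) :=
        sub_le_self _ (by positivity)

lemma eventually_deviation_bound {β γ : ℝ} (ha : 0 ≤ a) (h₀ : a = 0 → 4 / 27 * β < γ)
    (h₁ : 0 < a → β / 8 + a ^ 2 / 8 < γ) (hβ : 0 ≤ β) :
    ∀ᶠ δ in 𝓝[>] 0, ∀ u ∈ Icc (0 : ℝ) 1,
      (a * (1 - u) + δ * (β / 2 * (1 - u) ^ 2 - a ^ 2 * ((1 - u) ^ 2 / 2 + u * (1 - u)))) *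
        (u + δ * (a / 2 + γ * δ)) < a / 4 + γ / 2 * δ := by
  let d : ℝ → ℝ := fun u => β / 2 * (1 - u) ^ 2 - a ^ 2 * ((1 - u) ^ 2 / 2 + u * (1 - u))
  let q : ℝ → ℝ → ℝ := fun δ u =>
    γ / 2 - u * d u - (a ^ 2 / 2 * (1 - u) + δ * (a * γ * (1 - u) + d u * (a / 2 + γ * δ)))
  have hq : Continuous (Function.uncurry q) := by fun_prop
  have hzero : ∀ u ∈ Icc (0 : ℝ) 1, a * (u - 1 / 2) ^ 2 = 0 → 0 < q 0 u := by
    intro u hu hpu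
    rcases ha.eq_or_lt with rfl | ha
    · have hcubic : u * (1 - u) ^ 2 ≤ 4 / 27 := by
        nlinarith [mul_nonneg (sq_nonneg (u - 1 / 3)) (by linarith [hu.2] : 0 ≤ 4 / 3 - u)]
      have := mul_le_mul_of_nonneg_left hcubic hβ
      simp only [q, d]
      linarith [h₀ rfl]
    · have hu : u = 1 / 2 := by
        rcases mul_eq_zero.1 hpu with h | h
        · exact absurd h ha.ne'
        · linarith [pow_eq_zero_iff two_ne_zero |>.1 h]
      simp only [q, d, hu]
      linarith [h₁ ha]
  filter_upwards [eventually_forall_pos_add_mul isCompact_Icc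
    (by fun_prop : Continuous fun u : ℝ => a * (u - 1 / 2) ^ 2) hq
    (fun u _ => mul_nonneg ha (sq_nonneg _)) hzero] with δ hδ u hu
  have := hδ u hu
  simp only [q, d] at this
  linarith

end Expansion

section SmallCosts

open Asymptotics

variable {μ : Measure ℝ} {V W a b : ℝ}

lemma nonneg_of_cdf_isLittleO
    (hF : (fun s => cdf μ (V + s) - (a * s + b / 2 * s ^ 2)) =o[𝓝[>] 0] fun s => s ^ 2) :
    0 ≤ a := by
  have hlim : Tendsto (fun s : ℝ => a + (b / 2 + 1) * s) (𝓝[>] 0) (𝓝 a) := by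
    have hcont : Continuous fun s : ℝ => a + (b / 2 + 1) * s := by fun_prop
    simpa using (hcont.tendsto 0).mono_left nhdsWithin_le_nhds
  refine ge_of_tendsto hlim ?_
  filter_upwards [eventually_lt_of_isLittleO hF one_pos, self_mem_nhdsWithin] with s hsmall hs
  have hs : 0 < s := hs
  have hprod : 0 < s * (a + (b / 2 + 1) * s) := by
    linarith [(abs_lt.1 hsmall).2, cdf_nonneg μ (V + s)]
  exact (pos_of_mul_pos_right hprod hs.le).le

lemma eventually_mul_secondDemand_le [IsProbabilityMeasure μ] (hs : ∀ᵐ v ∂μ, v ∈ Icc V W)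
    (hF : (fun s => cdf μ (V + s) - (a * s + b / 2 * s ^ 2)) =o[𝓝[>] 0] fun s => s ^ 2)
    {β γ : ℝ} (hb : 0 < b) (hβ : b < β) (h₀ : a = 0 → 4 / 27 * β < γ)
    (h₁ : 0 < a → β / 8 + a ^ 2 / 8 < γ) :
    ∀ᶠ δ in 𝓝[>] 0, ∀ x, 0 < x → x * secondDemand μ (V + δ) x ≤
      (a / 2 * δ ^ 2 + γ * δ ^ 3) * (1 / 2 - secondDemand μ (V + δ) x) := by
  have ha : 0 ≤ a := nonneg_of_cdf_isLittleO hF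
  have hγ : 0 < γ := by
    rcases ha.eq_or_lt with ha | ha
    · linarith [h₀ ha.symm]
    · linarith [h₁ ha, sq_nonneg a]
  have haδ : ∀ᶠ δ in 𝓝[>] (0 : ℝ), a * δ < 1 := by
    have hcont : Continuous fun δ : ℝ => a * δ := by fun_prop
    exact nhdsWithin_le_nhds ((hcont.tendsto 0).eventually (gt_mem_nhds (by simp)))
  obtain ⟨η, hη, hbounds⟩ := mem_nhdsGT_iff_exists_Ioo_subset.1 (eventually_cdf_bounds hF hb hβ)
  filter_upwards [eventually_deviation_bound ha h₀ h₁ (hb.trans hβ).le, haδ, Ioo_mem_nhdsGT hη]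
    with δ hpoly haδ hδ x hx
  have hδ₀ : 0 < δ := hδ.1
  rcases le_or_gt δ x with hxδ | hxδ
  · rw [secondDemand_eq_zero hs (by simpa using hxδ)]
    have : 0 ≤ a / 2 * δ ^ 2 + γ * δ ^ 3 := by positivity
    linarith
  · have hdemand := secondDemand_le_quadratic (x := x) (y := δ - x) hs hx (sub_pos.2 hxδ) ha
      (hb.trans hβ).le (by simpa using haδ.le) fun s hs =>
        hbounds ⟨hs.1, hs.2.trans_lt (by simpa using hδ.2)⟩
    rw [add_sub_cancel] at hdemand
    have hscaled := mul_le_mul_of_nonneg_left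
      (hpoly (x / δ) ⟨by positivity, (div_le_one hδ₀).2 hxδ.le⟩).le (sq_nonneg δ)
    have hmul := mul_le_mul_of_nonneg_right hdemand
      (by positivity : 0 ≤ x + (a / 2 * δ ^ 2 + γ * δ ^ 3))
    obtain ⟨u, rfl⟩ : ∃ u, x = u * δ := ⟨x / δ, by field_simp⟩
    rw [mul_div_cancel_right₀ u hδ₀.ne'] at hscaled
    linarith

lemma exists_between_demand_and_gain_coefficients (ha : 0 ≤ a) (hab : a ^ 2 < 1 / 11 * b) :
    ∃ β γ : ℝ, b < β ∧ γ < b / 6 - a ^ 2 / 3 ∧ (a = 0 → 4 / 27 * β < γ) ∧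
      (0 < a → β / 8 + a ^ 2 / 8 < γ) := by
  rcases ha.eq_or_lt with rfl | ha
  · exact ⟨b * (33 / 32), b * (17 / 108), by linarith, by linarith, fun _ => by linarith,
      fun h => absurd h (lt_irrefl _)⟩
  · exact ⟨b + (b - 11 * a ^ 2) / 48, 7 * b / 48 - 5 * a ^ 2 / 48, by linarith, by linarith,
      fun h => absurd h ha.ne', fun _ => by linarith⟩

lemma eventually_integral_lt_surplusAtTStar [IsProbabilityMeasure μ] [NullSingletonClass μ]
    (hs : ∀ᵐ v ∂μ, v ∈ Icc V W) (hW : W ≤ 2 * V)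
    (hF : (fun s => cdf μ (V + s) - (a * s + b / 2 * s ^ 2)) =o[𝓝[>] 0] fun s => s ^ 2)
    (hab : a ^ 2 < 1 / 11 * b) :
    ∀ᶠ c in 𝓝[<] (cBar μ V), ∫ v, v ∂μ < surplusAtTStar μ V c := by
  have hb : 0 < b := by linarith [sq_nonneg a]
  obtain ⟨β, γ, hβ, hγ, h₀, h₁⟩ :=
    exists_between_demand_and_gain_coefficients (nonneg_of_cdf_isLittleO hF) hab
  have hδ : Tendsto (fun c => theta0 μ c - V) (𝓝[<] (cBar μ V)) (𝓝[>] 0) := by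
    refine tendsto_nhdsWithin_iff.2 ⟨?_, ?_⟩
    · simpa using ((tendsto_theta0_cBar hs).mono_right nhdsWithin_le_nhds).sub_const V
    · filter_upwards [(tendsto_theta0_cBar hs).eventually self_mem_nhdsWithin] with c hc
        using sub_pos.2 hc
  filter_upwards [hδ.eventually (eventually_lt_integral_cdf_mul hF hγ),
    hδ.eventually (eventually_mul_secondDemand_le hs hF hb hβ h₀ h₁),
    hδ.eventually self_mem_nhdsWithin, eventually_surplusAtTStar_eq hs hW,
    nhdsWithin_le_nhds (lt_mem_nhds (cBar_pos hs))] with c hgain hdemand hpos hsurplus hc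
  rw [add_sub_cancel] at hgain hdemand
  rw [← integral_max_searchGain_sub_eq hs (sub_pos.1 hpos).le,
    searchGain_theta0 hs (le_of_lt hc)] at hgain
  rw [hsurplus, searchWelfare]
  linarith [tStar_le hs hdemand]

end SmallCosts

section Density

open Asymptotics

variable {μ : Measure ℝ} {f : ℝ → ℝ} {V a b : ℝ}

lemma isLittleO_of_tendsto_deriv (hdiff : ∀ᶠ x in 𝓝[>] V, DifferentiableAt ℝ f x)
    (hf : Tendsto f (𝓝[>] V) (𝓝 a)) (hderiv : Tendsto (deriv f) (𝓝[>] V) (𝓝 b)) :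
    (fun s => f (V + s) - (a + b * s)) =o[𝓝[>] 0] fun s => s := by
  set F := Function.update f V a with hFdef
  have hFf : ∀ x, V < x → F =ᶠ[𝓝 x] f := fun x hx => by
    filter_upwards [lt_mem_nhds hx] with y hy
    exact Function.update_of_ne (ne_of_gt hy) _ _
  have hF : HasDerivWithinAt F b (Ici V) V := by
    obtain ⟨s, hs, hsdiff⟩ := hdiff.exists_mem
    refine hasDerivWithinAt_Ici_of_tendsto_deriv (s := s ∩ Ioi V) (fun x hx => ?_) ?_
      (inter_mem hs self_mem_nhdsWithin) (hderiv.congr' ?_)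
    · exact ((hFf x hx.2).differentiableAt_iff.2 (hsdiff x hx.1)).differentiableWithinAt
    · rw [ContinuousWithinAt, hFdef, Function.update_self]
      refine (hf.congr' ?_).mono_left (nhdsWithin_mono V inter_subset_right)
      filter_upwards [self_mem_nhdsWithin] with x hx using (hFf x hx).eq_of_nhds.symm
    · filter_upwards [self_mem_nhdsWithin] with x hx using (hFf x hx).deriv_eq.symm
  have hshift : Tendsto (fun s => V + s) (𝓝[>] 0) (𝓝[>] V) := by
    refine tendsto_nhdsWithin_iff.2 ⟨?_, ?_⟩
    · simpa using ((continuous_const_add V).tendsto 0).mono_left nhdsWithin_le_nhds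
    · filter_upwards [self_mem_nhdsWithin] with s hs using lt_add_of_pos_right V hs
  refine ((hF.Ioi_of_Ici.isLittleO.comp_tendsto hshift).congr' ?_ ?_)
  · filter_upwards [self_mem_nhdsWithin] with s hs
    have hs : V < V + s := lt_add_of_pos_right V hs
    simp only [Function.comp_apply, hFdef, Function.update_self, Function.update_of_ne hs.ne',
      add_sub_cancel_left, smul_eq_mul]
    ring
  · exact Eventually.of_forall fun s => add_sub_cancel_left V s

lemma integrable_of_eq_withDensity [IsFiniteMeasure μ] (hmeas : Measurable f)
    (hnonneg : ∀ x, 0 ≤ f x) (hμ : μ = volume.withDensity fun x => ENNReal.ofReal (f x)) :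
    Integrable f := by
  refine (lintegral_ofReal_ne_top_iff_integrable hmeas.aestronglyMeasurable
    (ae_of_all _ hnonneg)).1 ?_
  rw [← setLIntegral_univ, ← withDensity_apply _ MeasurableSet.univ, ← hμ]
  exact measure_ne_top μ univ

lemma cdf_eq_integral [IsProbabilityMeasure μ] (hmeas : Measurable f) (hnonneg : ∀ x, 0 ≤ f x)
    (hμ : μ = volume.withDensity fun x => ENNReal.ofReal (f x)) (hsupp : ∀ x < V, f x = 0) {y : ℝ}
    (hy : V ≤ y) : cdf μ y = ∫ x in V..y, f x := by
  calc cdf μ y = ∫ x in Iic y, f x := by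
        rw [cdf_eq_real, Measure.real, hμ, withDensity_apply _ measurableSet_Iic,
          integral_eq_lintegral_of_nonneg_ae (ae_of_all _ hnonneg) hmeas.aestronglyMeasurable]
    _ = ∫ x in Ioc V y, f x := by
        refine setIntegral_eq_of_subset_of_ae_sdiff_eq_zero nullMeasurableSet_Iic
          Ioc_subset_Iic_self ?_
        filter_upwards [compl_mem_ae_iff.2 (measure_singleton V)] with x hx hxy
        exact hsupp x (lt_of_le_of_ne (not_lt.1 fun h => hxy.2 ⟨h, hxy.1⟩) hx)
    _ = ∫ x in V..y, f x := (intervalIntegral.integral_of_le hy).symm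

lemma cdf_isLittleO_of_tendsto_deriv [IsProbabilityMeasure μ] (hmeas : Measurable f)
    (hnonneg : ∀ x, 0 ≤ f x) (hμ : μ = volume.withDensity fun x => ENNReal.ofReal (f x))
    (hsupp : ∀ x < V, f x = 0) (hdiff : ∀ᶠ x in 𝓝[>] V, DifferentiableAt ℝ f x)
    (hf : Tendsto f (𝓝[>] V) (𝓝 a)) (hderiv : Tendsto (deriv f) (𝓝[>] V) (𝓝 b)) :
    (fun s => cdf μ (V + s) - (a * s + b / 2 * s ^ 2)) =o[𝓝[>] 0] fun s => s ^ 2 := by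
  have hint : Integrable f := integrable_of_eq_withDensity hmeas hnonneg hμ
  refine (isLittleO_integral_pow_succ (n := 1) ((isLittleO_of_tendsto_deriv hdiff hf
    hderiv).congr_right fun s => (pow_one s).symm)).congr' ?_ (Eventually.of_forall fun s => rfl)
  filter_upwards [self_mem_nhdsWithin] with s hs
  have hs : V ≤ V + s := (lt_add_of_pos_right V hs).le
  rw [intervalIntegral.integral_sub (hint.comp_add_left V).intervalIntegrable
    (Continuous.intervalIntegrable (by fun_prop) _ _), intervalIntegral.integral_comp_add_left,
    add_zero, ← cdf_eq_integral hmeas hnonneg hμ hsupp hs,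
    intervalIntegral.integral_add intervalIntegrable_const
    (Continuous.intervalIntegrable (by fun_prop) _ _), intervalIntegral.integral_const,
    intervalIntegral.integral_const_mul, integral_id]
  simp only [smul_eq_mul]
  ring

end Density

end ProminenceMarket

open ProminenceMarket Asymptotics in
theorem mainTheorem11_general {V W : ℝ} (hW : W ≤ 2 * V) (μ : MeasureTheory.Measure ℝ)
    [IsProbabilityMeasure μ] [NullSingletonClass μ] (hs : ∀ᵐ v ∂μ, v ∈ Icc V W) {f₀ f₁ : ℝ}
    (hF : (fun s => cdf μ (V + s) - (f₀ * s + f₁ / 2 * s ^ 2)) =o[𝓝[>] 0] fun s => s ^ 2)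
    (hcond : f₀ ^ 2 < 1 / 11 * f₁) :
    (∀ c ∈ Icc 0 (cBar μ V), surplusAtTStar μ V c = welfareAtTStar μ V c - tStar μ V c) ∧
    (∀ c ∈ Ioo 0 (cBar μ V), surplusAtTStar μ V c ∈ upperBounds (achievableSurplus μ c)) ∧
    Tendsto (surplusAtTStar μ V) (𝓝[>] 0) (𝓝 (surplusAtTStar μ V 0)) ∧
    Tendsto (surplusAtTStar μ V) (𝓝[<] (cBar μ V)) (𝓝 (∫ v, v ∂μ)) ∧
    (∀ᶠ c in 𝓝[<] (cBar μ V),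
      IsLeast (implementablePrices μ c) (tStar μ V c) ∧
      IsGreatest (achievableSurplus μ c) (surplusAtTStar μ V c) ∧
      ∫ v, v ∂μ < surplusAtTStar μ V c) ∧
    (∃ c' ∈ Ico 0 (cBar μ V),
      (∀ c ∈ Icc 0 (cBar μ V), surplusAtTStar μ V c ≤ surplusAtTStar μ V c') ∧
      ∫ v, v ∂μ < surplusAtTStar μ V c') := by
  have hlt := eventually_integral_lt_surplusAtTStar hs hW hF hcond
  refine ⟨fun c hc => ?_,
    fun c hc => surplusAtTStar_mem_upperBounds hs hW (Ioo_subset_Ioc_self hc),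
    tendsto_surplusAtTStar_zero hs hW, tendsto_surplusAtTStar_cBar hs hW, ?_,
    exists_surplusAtTStar_max_lt hs hW hlt⟩
  · rw [surplusAtTStar_eq hs hW hc, welfareAtTStar_eq hs hW hc]
  · filter_upwards [eventually_isLeast_and_isGreatest hs hW, hlt] with c hopt hlt
    exact ⟨hopt.1, hopt.2, hlt⟩

theorem mainTheorem11 (V : ℝ) (hV : 2 ≤ V)
    (f : ℝ → ℝ) (hf_meas : Measurable f) (hf_nonneg : ∀ x, 0 ≤ f x)
    (hf_supp : ∀ x, x ∉ Set.Icc V (V + 1) → f x = 0)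
    (μ : MeasureTheory.Measure ℝ) [MeasureTheory.IsProbabilityMeasure μ]
    (hμ : μ = MeasureTheory.volume.withDensity fun x => ENNReal.ofReal (f x))
    (f₀ f₁ : ℝ)
    (hf_diff : ∀ᶠ x in 𝓝[>] V, DifferentiableAt ℝ f x)
    (hf₀ : Filter.Tendsto f (𝓝[>] V) (𝓝 f₀))
    (hf₁ : Filter.Tendsto (deriv f) (𝓝[>] V) (𝓝 f₁))
    (hcond : f₀ ^ 2 < 1 / 13 * f₁) :
    -- the surplus at the lowest price is welfare minus that price
    (∀ c ∈ Set.Icc 0 (ProminenceMarket.cBar μ V),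
      ProminenceMarket.surplusAtTStar μ V c =
        ProminenceMarket.welfareAtTStar μ V c - ProminenceMarket.tStar μ V c) ∧
    -- it bounds every surplus achievable at a symmetric equilibrium of a standard mechanism
    (∀ c ∈ Set.Ioo 0 (ProminenceMarket.cBar μ V),
      ProminenceMarket.surplusAtTStar μ V c ∈
        upperBounds (ProminenceMarket.achievableSurplus μ c)) ∧
    -- its limits at the two ends of the range of costs
    Filter.Tendsto (ProminenceMarket.surplusAtTStar μ V) (𝓝[>] 0)
      (𝓝 (ProminenceMarket.surplusAtTStar μ V 0)) ∧
    Filter.Tendsto (ProminenceMarket.surplusAtTStar μ V) (𝓝[<] (ProminenceMarket.cBar μ V))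
      (𝓝 (∫ v, v ∂μ)) ∧
    -- costs slightly below the maximal one are strictly better than the limit there, and the
    -- surplus in question is the highest one achieved at equilibrium
    (∀ᶠ c in 𝓝[<] (ProminenceMarket.cBar μ V),
      IsLeast (ProminenceMarket.implementablePrices μ c) (ProminenceMarket.tStar μ V c) ∧
      IsGreatest (ProminenceMarket.achievableSurplus μ c)
        (ProminenceMarket.surplusAtTStar μ V c) ∧
      ∫ v, v ∂μ < ProminenceMarket.surplusAtTStar μ V c) ∧
    -- the maximum is attained, and not at the maximal cost
    (∃ c' ∈ Set.Ico 0 (ProminenceMarket.cBar μ V),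
      (∀ c ∈ Set.Icc 0 (ProminenceMarket.cBar μ V),
        ProminenceMarket.surplusAtTStar μ V c ≤ ProminenceMarket.surplusAtTStar μ V c') ∧
      ∫ v, v ∂μ < ProminenceMarket.surplusAtTStar μ V c') := by
  have hs : ∀ᵐ v ∂μ, v ∈ Icc V (V + 1) := by
    rw [hμ, ae_withDensity_iff (by fun_prop)]
    exact ae_of_all _ fun v hv => by_contra fun hv' => hv (by simp [hf_supp v hv'])
  have hnull : NullSingletonClass μ := hμ ▸ inferInstance
  have hF := ProminenceMarket.cdf_isLittleO_of_tendsto_deriv hf_meas hf_nonneg hμ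
    (fun x hx => hf_supp x fun h => hx.not_ge h.1) hf_diff hf₀ hf₁
  exact mainTheorem11_general (by linarith) μ hs hF (by linarith [sq_nonneg f₀])
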